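/- **Theorem (Unique information for the continuous $I_\cap^{\min}$ and $I_\cap^{\mathrm{PM}}$ decompositions).** Let $\log$ be the logarithm to a fixed base $b>1$. Let $X,Y,T$ be real random variables on a probability space such that $T=g(X,Y)$ for every realization, where $g$ is continuous on the set of values of $(X,Y)$, and $(X,Y)$ has a density with respect to Lebesgue measure (a *noise-free bivariate interaction*). Suppose it is *well-behaved*: there is an open set $U\subset\mathbb R^2$ with $\mathbb P((X,Y)\in U)=1$ such that $g\in C^1(U)$, $|\partial_x g|>0$ and $|\partial_y g|>0$ on $U$, and for all $x,y$ the maps $g(x,\cdot)$ and $g(\cdot,y)$ are injective on the corresponding sections $\{y:(x,y)\in U\}$, $\{x:(x,y)\in U\}$ (so that the inverses $(g(x,\cdot))^{-1}$, $(g(\cdot,y))^{-1}$ exist). Notation: $p_X,p_Y,p_T,p_{X,T},p_{Y,T}$ are densities (it is part of the claim that those of $T$, $(X,T)$, $(Y,T)$ exist), and $p_{X|T}(x|t)=p_{X,T}(x,t)/p_T(t)$, similarly $p_{Y|T}$. Let $I(T;X)=D(P_{T,X}\,\|\,P_T\otimes P_X)$ be the mutual information and $I_X(t)=D(P_{X|T=t}\,\|\,P_X)$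 the specific information (similarly for $Y$), where $D$ is Kullback–Leibler divergence to base $b$. Define, with values in $[-\infty,\infty]$, $$I_\cap^{\min}(T;X,Y)=\mathbb E\min(I_X(T),I_Y(T)),\qquad U_X^{\min}=I(T;X)-I_\cap^{\min}(T;X,Y),$$ $$(U_X^{\mathrm{PM}})^+=\mathbb E\log\tfrac1{p_X(X)}-\mathbb E\min\Big(\log\tfrac1{p_X(X)},\log\tfrac1{p_Y(Y)}\Big),$$ $$(U_X^{\mathrm{PM}})^-=\mathbb E\log\tfrac1{p_{X|T}(X|T)}-\mathbb E\min\Big(\log\tfrac1{p_{X|T}(X|T)},\log\tfrac1{p_{Y|T}(Y|T)}\Big),$$ $$U_X^{\mathrm{PM}}=(U_X^{\mathrm{PM}})^+-(U_X^{\mathrm{PM}})^- .$$ Call such a quantity *defined* if the expectations in it exist in $[-\infty,\infty]$ and no difference in it has the form $\infty-\infty$ or $(-\infty)-(-\infty)$. Partial derivatives of $g$ are evaluated at $(X,Y)$. Let $$A=\{I_X(T)\ge I_Y(T)\},\qquad B=\{p_X(X)\le p_Y(Y)\},\qquad C=\{|\partial_x g|\le|\partial_y g|\}.$$ Then the following hold,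 each for the quantities that are defined, and in (1), (2) and (3) the expectation on the right exists in $[-\infty,\infty]$: 1. $\displaystyle U_X^{\min}=\mathbb E\Big[\mathbf 1_A\Big(\log\frac{p_Y(Y)}{p_X(X)}-\log\frac{|\partial_y g|}{|\partial_x g|}\Big)\Big]$; 2. $\displaystyle (U_X^{\mathrm{PM}})^+=\mathbb E\Big[\mathbf 1_B\log\frac{p_Y(Y)}{p_X(X)}\Big]$; 3. $\displaystyle (U_X^{\mathrm{PM}})^-=\mathbb E\Big[\mathbf 1_C\log\frac{|\partial_y g|}{|\partial_x g|}\Big]$; 4. $\displaystyle U_X^{\mathrm{PM}}=\mathbb E\Big[\mathbf 1_B\log\frac{p_Y(Y)}{p_X(X)}\Big]-\mathbb E\Big[\mathbf 1_C\log\frac{|\partial_y g|}{|\partial_x g|}\Big]$. If moreover $(X,Y)$ is Gaussian with means $0$, variances $1$ and covariance $\rho$, then almost surely $\log\frac{p_Y(Y)}{p_X(X)}=\frac{\log e}{2}(X^2-Y^2)$; if $U_X^{\min}$ is defined, then $$U_X^{\min}=\mathbb E\Big[\mathbf 1_A\Big(\frac{\log e}{2}(X^2-Y^2)-\log\frac{|\partial_y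 g|}{|\partial_x g|}\Big)\Big],$$ where the expectation exists in $[-\infty,\infty]$; $(U_X^{\mathrm{PM}})^+$ is always defined and equals $\frac{\log e}{\pi}\sqrt{1-\rho^2}$; and if $(U_X^{\mathrm{PM}})^-$ is defined, then $$U_X^{\mathrm{PM}}=\frac{\log e}{\pi}\sqrt{1-\rho^2}-\mathbb E\Big[\mathbf 1_C\log\frac{|\partial_y g|}{|\partial_x g|}\Big].$$ -/

import Mathlib

open MeasureTheory ProbabilityTheory InformationTheory
open scoped ENNReal

noncomputable section

namespace PIDCont

variable {Ω : Type*} [MeasurableSpace Ω]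

/-! ### Extended expectations -/

/-- The expectation of `f` exists as an element of `[-∞, ∞]`: `f` is (a.e.) measurable and its
positive and negative parts do not both have infinite integral. -/
def ExpectationExists (μ : Measure Ω) (f : Ω → ℝ) : Prop :=
  AEMeasurable f μ ∧
    ((∫⁻ ω, ENNReal.ofReal (f ω) ∂μ) ≠ ⊤ ∨ (∫⁻ ω, ENNReal.ofReal (-f ω) ∂μ) ≠ ⊤)

/-- The expectation `E f = E f⁺ - E f⁻` in `[-∞, ∞]`; meaningful if `ExpectationExists μ f`. -/
def expectation (μ : Measure Ω) (f : Ω → ℝ) : EReal :=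
  ((∫⁻ ω, ENNReal.ofReal (f ω) ∂μ : ℝ≥0∞) : EReal)
    - ((∫⁻ ω, ENNReal.ofReal (-f ω) ∂μ : ℝ≥0∞) : EReal)

/-- The difference `a - b` of extended reals is not of the form `∞ - ∞` or `(-∞) - (-∞)`. -/
def DiffDefined (a b : EReal) : Prop :=
  ¬ (a = ⊤ ∧ b = ⊤) ∧ ¬ (a = ⊥ ∧ b = ⊥)

/-! ### Noise-free bivariate interactions -/

/-- `X, Y → T` is a noise-free bivariate interaction with kernel `g`: real random variables with
`T = g (X, Y)` for every realization, `g` continuous on the set of values of `(X, Y)`,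
and `(X, Y)` admitting a density with respect to Lebesgue measure. -/
structure IsNFBI (μ : Measure Ω) (X Y T : Ω → ℝ) (g : ℝ × ℝ → ℝ) : Prop where
  measurable_X : Measurable X
  measurable_Y : Measurable Y
  measurable_T : Measurable T
  continuousOn : ContinuousOn g (Set.range fun ω => (X ω, Y ω))
  eq_kernel : ∀ ω, T ω = g (X ω, Y ω)
  hasPDF : HasPDF (fun ω => (X ω, Y ω)) μ volume

/-- The partial derivative `∂ₓ g`. -/
def dX (g : ℝ × ℝ → ℝ) (z : ℝ × ℝ) : ℝ := deriv (fun s => g (s, z.2)) z.1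

/-- The partial derivative `∂_y g`. -/
def dY (g : ℝ × ℝ → ℝ) (z : ℝ × ℝ) : ℝ := deriv (fun s => g (z.1, s)) z.2

/-- Well-behaved kernels: there is an open set `U` carrying the law of `(X, Y)` such that
`g` is `C¹` on `U`, both partial derivatives vanish nowhere on `U`, and the inverses
`(g (x, ·))⁻¹` and `(g (·, y))⁻¹` make sense on the sections of `U`. -/
def IsWellBehaved (μ : Measure Ω) (X Y : Ω → ℝ) (g : ℝ × ℝ → ℝ) : Prop :=
  ∃ U : Set (ℝ × ℝ), IsOpen U ∧ (∀ᵐ ω ∂μ, (X ω, Y ω) ∈ U) ∧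
    ContDiffOn ℝ 1 g U ∧
    (∀ z ∈ U, 0 < |dX g z| ∧ 0 < |dY g z|) ∧
    (∀ x, Set.InjOn (fun y => g (x, y)) {y | (x, y) ∈ U}) ∧
    (∀ y, Set.InjOn (fun x => g (x, y)) {x | (x, y) ∈ U})

/-- `(X, Y) ∼ N(0, (1, ρ; ρ, 1))`. -/
structure IsNormalizedGaussian (μ : Measure Ω) (X Y : Ω → ℝ) (ρ : ℝ) : Prop where
  gaussian : HasGaussianLaw (fun ω => (X ω, Y ω)) μ
  mean_X : ∫ ω, X ω ∂μ = 0
  mean_Y : ∫ ω, Y ω ∂μ = 0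
  var_X : variance X μ = 1
  var_Y : variance Y μ = 1
  cov_XY : covariance X Y μ = ρ

/-! ### Densities -/

/-- The density `p_X` of a real random variable. -/
def dens (μ : Measure Ω) (X : Ω → ℝ) (x : ℝ) : ℝ := (pdf X μ volume x).toReal

/-- The conditional density `p_{X|T}(x|t) = p_{X,T}(x,t) / p_T(t)`. -/
def condDens (μ : Measure Ω) (X T : Ω → ℝ) (x t : ℝ) : ℝ :=
  (pdf (fun ω => (X ω, T ω)) μ volume (x, t)).toReal / dens μ T t

/-! ### The decomposition based on `I_min`. Logarithms are to base `b`. -/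

/-- Mutual information `I(T;X) = D(P_{T,X} ‖ P_T ⊗ P_X)`; the factor `log_b e` changes nats to
base `b`. -/
def mutualInfo (b : ℝ) (μ : Measure Ω) (T X : Ω → ℝ) : ℝ≥0∞ :=
  ENNReal.ofReal (Real.logb b (Real.exp 1)) *
    klDiv (μ.map fun ω => (T ω, X ω)) ((μ.map T).prod (μ.map X))

/-- Specific information `I_X(t) = D(P_{X|T=t} ‖ P_X)`, to base `b`. -/
def specificInfo (b : ℝ) (μ : Measure Ω) [IsFiniteMeasure μ] (X T : Ω → ℝ) (t : ℝ) : ℝ≥0∞ :=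
  ENNReal.ofReal (Real.logb b (Real.exp 1)) * klDiv (condDistrib X T μ t) (μ.map X)

/-- The redundancy `I_min(T;X,Y) = E min (I_X(T), I_Y(T))`. -/
def redundancyMin (b : ℝ) (μ : Measure Ω) [IsFiniteMeasure μ] (T X Y : Ω → ℝ) : ℝ≥0∞ :=
  ∫⁻ ω, min (specificInfo b μ X T (T ω)) (specificInfo b μ Y T (T ω)) ∂μ

/-- Unique information of `X`: `U_X = I(T;X) - I_min(T;X,Y)`. -/
def uniqueMin (b : ℝ) (μ : Measure Ω) [IsFiniteMeasure μ] (T X Y : Ω → ℝ) : EReal :=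
  (mutualInfo b μ T X : EReal) - (redundancyMin b μ T X Y : EReal)

/-- `uniqueMin` is not an indeterminate difference. -/
def UniqueMinDefined (b : ℝ) (μ : Measure Ω) [IsFiniteMeasure μ] (T X Y : Ω → ℝ) : Prop :=
  DiffDefined (mutualInfo b μ T X : EReal) (redundancyMin b μ T X Y : EReal)

/-! ### The decomposition based on `I_PM`: specificity (`Plus`) and ambiguity (`Minus`) -/

/-- Pointwise specificity `log (1 / p_X(X))`. -/
def pointSpec (b : ℝ) (μ : Measure Ω) (X : Ω → ℝ) (ω : Ω) : ℝ :=
  Real.logb b (1 / dens μ X (X ω))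

/-- Pointwise ambiguity `log (1 / p_{X|T}(X|T))`. -/
def pointAmb (b : ℝ) (μ : Measure Ω) (T X : Ω → ℝ) (ω : Ω) : ℝ :=
  Real.logb b (1 / condDens μ X T (X ω) (T ω))

/-- Redundant specificity before averaging: `min (log 1/p_X(X), log 1/p_Y(Y))`. -/
def pointSpecRed (b : ℝ) (μ : Measure Ω) (X Y : Ω → ℝ) (ω : Ω) : ℝ :=
  min (pointSpec b μ X ω) (pointSpec b μ Y ω)

/-- Redundant ambiguity before averaging: `min (log 1/p_{X|T}(X|T), log 1/p_{Y|T}(Y|T))`. -/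
def pointAmbRed (b : ℝ) (μ : Measure Ω) (T X Y : Ω → ℝ) (ω : Ω) : ℝ :=
  min (pointAmb b μ T X ω) (pointAmb b μ T Y ω)

/-- Unique specificity `U_X⁺ = E log (1/p_X(X)) - E min (log 1/p_X(X), log 1/p_Y(Y))`. -/
def uniquePMPlus (b : ℝ) (μ : Measure Ω) (X Y : Ω → ℝ) : EReal :=
  expectation μ (pointSpec b μ X) - expectation μ (pointSpecRed b μ X Y)

/-- Both expectations in `uniquePMPlus` exist, and their difference is determinate. -/
def UniquePMPlusDefined (b : ℝ) (μ : Measure Ω) (X Y : Ω → ℝ) : Prop :=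
  ExpectationExists μ (pointSpec b μ X) ∧ ExpectationExists μ (pointSpecRed b μ X Y) ∧
    DiffDefined (expectation μ (pointSpec b μ X)) (expectation μ (pointSpecRed b μ X Y))

/-- Unique ambiguity
`U_X⁻ = E log (1/p_{X|T}(X|T)) - E min (log 1/p_{X|T}(X|T), log 1/p_{Y|T}(Y|T))`. -/
def uniquePMMinus (b : ℝ) (μ : Measure Ω) (T X Y : Ω → ℝ) : EReal :=
  expectation μ (pointAmb b μ T X) - expectation μ (pointAmbRed b μ T X Y)

/-- Both expectations in `uniquePMMinus` exist, and their difference is determinate. -/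
def UniquePMMinusDefined (b : ℝ) (μ : Measure Ω) (T X Y : Ω → ℝ) : Prop :=
  ExpectationExists μ (pointAmb b μ T X) ∧ ExpectationExists μ (pointAmbRed b μ T X Y) ∧
    DiffDefined (expectation μ (pointAmb b μ T X)) (expectation μ (pointAmbRed b μ T X Y))

/-- Unique information of `X`: `U_X = U_X⁺ - U_X⁻`. -/
def uniquePM (b : ℝ) (μ : Measure Ω) (T X Y : Ω → ℝ) : EReal :=
  uniquePMPlus b μ X Y - uniquePMMinus b μ T X Y

/-- All differences entering `uniquePM` are determinate. -/
def UniquePMDefined (b : ℝ) (μ : Measure Ω) (T X Y : Ω → ℝ) : Prop :=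
  UniquePMPlusDefined b μ X Y ∧ UniquePMMinusDefined b μ T X Y ∧
    DiffDefined (uniquePMPlus b μ X Y) (uniquePMMinus b μ T X Y)

/-! ### The events and integrands of the closed forms -/

/-- The event `A = {I_X(T) ≥ I_Y(T)}`. -/
def eventA (b : ℝ) (μ : Measure Ω) [IsFiniteMeasure μ] (T X Y : Ω → ℝ) : Set Ω :=
  {ω | specificInfo b μ X T (T ω) ≥ specificInfo b μ Y T (T ω)}

/-- The event `B = {p_X(X) ≤ p_Y(Y)}`. -/
def eventB (μ : Measure Ω) (X Y : Ω → ℝ) : Set Ω :=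
  {ω | dens μ X (X ω) ≤ dens μ Y (Y ω)}

/-- The event `C = {|∂ₓ g|(X,Y) ≤ |∂_y g|(X,Y)}`. -/
def eventC (X Y : Ω → ℝ) (g : ℝ × ℝ → ℝ) : Set Ω :=
  {ω | |dX g (X ω, Y ω)| ≤ |dY g (X ω, Y ω)|}

/-- `log (p_Y(Y) / p_X(X))`. -/
def logDensRatio (b : ℝ) (μ : Measure Ω) (X Y : Ω → ℝ) (ω : Ω) : ℝ :=
  Real.logb b (dens μ Y (Y ω) / dens μ X (X ω))

/-- `log (|∂_y g| / |∂ₓ g|)` at `(X, Y)`. -/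
def logDerivRatio (b : ℝ) (X Y : Ω → ℝ) (g : ℝ × ℝ → ℝ) (ω : Ω) : ℝ :=
  Real.logb b (|dY g (X ω, Y ω)| / |dX g (X ω, Y ω)|)

end PIDCont

end

/-!
The closed forms rest on one change of variables. On the open set `U` carrying the law of `(X, Y)`
the maps `(x, y) ↦ (x, g (x, y))` and `(x, y) ↦ (y, g (x, y))` are injective and `C¹`, with
Jacobians `|∂_y g|` and `|∂ₓ g|`. Hence `(X, T)` and `(Y, T)` have densities, and evaluated at the
random point `p_{X,Y} = |∂_y g| p_{X,T} = |∂ₓ g| p_{Y,T}`; dividing by `p_T` gives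
`|∂_y g| p_{X|T} = |∂ₓ g| p_{Y|T}` almost surely (`ae_abs_dY_mul_condDens_eq`). Only injectivity is
needed: no inverse function is written down, the density of the image being compared with the
original one on the images of measurable sets (`pdf_eq_abs_det_mul_pdf`).

For the pointwise decomposition, `f - min (f, h)` is `f - h` on `{h ≤ f}` and `0` elsewhere. For the
specificities this event is `B`; for the ambiguities it is `C`, by the identity above. It remains
that the extended expectation is additive on determinate differences (`expectation_sub`).

For `I_min`, the specific information integrated over an event `{T ∈ S}` equals the expectation
over that event of the pointwise information `log (p_{X|T} / p_X)`
(`setLIntegral_specificInfo_add`), and in particular mutual information is mean specific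
information. These identities hold in `[0, ∞]` because the negative part of a log-likelihood ratio
always has a finite integral. If `U_X` is not of the form `∞ - ∞`, the redundancy is finite, so it
may be subtracted on `A` and on the complement of `A` separately; the complement cancels, and on `A`
the difference of the pointwise informations is the claimed integrand.

For Gaussian predictors, `E[1_B (X² - Y²)] = E|X² - Y²| / 2`, because `X²` and `Y²` have the same
mean, and `X² - Y² = (X - Y)(X + Y)` is a product of independent centred Gaussian variables of
variances `2 (1 - ρ)` and `2 (1 + ρ)` (`integral_abs_sq_sub_sq`).
-/

namespace PIDCont

/-! ### Extended expectations -/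

section Expectation

variable {Ω : Type*} [MeasurableSpace Ω] {μ : Measure Ω}

theorem ExpectationExists.congr {f h : Ω → ℝ} (hf : ExpectationExists μ f) (hfh : f =ᵐ[μ] h) :
    ExpectationExists μ h := by
  refine ⟨hf.1.congr hfh, ?_⟩
  rw [← lintegral_congr_ae (hfh.mono fun ω hω => congrArg ENNReal.ofReal hω),
    ← lintegral_congr_ae (hfh.mono fun ω hω => congrArg (fun x => ENNReal.ofReal (-x)) hω)]
  exact hf.2

theorem expectation_congr {f h : Ω → ℝ} (hfh : f =ᵐ[μ] h) :
    expectation μ f = expectation μ h := by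
  unfold expectation
  rw [lintegral_congr_ae (hfh.mono fun ω hω => congrArg ENNReal.ofReal hω),
    lintegral_congr_ae (hfh.mono fun ω hω => congrArg (fun x => ENNReal.ofReal (-x)) hω)]

/-- If `a - b = p - n`, written additively, and one of `p`, `n` is finite, the two differences agree
as extended reals. -/
theorem ereal_sub_eq_of_add_eq_add {a b p n : ℝ≥0∞} (h : a + n = b + p) (hap : a ≤ p) (hbn : b ≤ n)
    (hpn : p ≠ ⊤ ∨ n ≠ ⊤) : (a : EReal) - (b : EReal) = (p : EReal) - (n : EReal) := by
  induction p with
  | top =>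
    have hn : n ≠ ⊤ := by simpa using hpn
    have hb : b ≠ ⊤ := ne_top_of_le_ne_top hn hbn
    have ha : a = ⊤ := by
      simp only [add_top, ENNReal.add_eq_top, hn, or_false] at h
      exact h
    subst ha
    lift n to NNReal using hn
    lift b to NNReal using hb
    simp [EReal.coe_ennreal_top, EReal.coe_nnreal_eq_coe_real]
  | coe p =>
    have ha : a ≠ ⊤ := ne_top_of_le_ne_top ENNReal.coe_ne_top hap
    lift a to NNReal using ha
    induction n with
    | top =>
      have hb : b = ⊤ := by simpa using h.symm
      subst hb
      simp [EReal.coe_ennreal_top, EReal.coe_nnreal_eq_coe_real]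
    | coe n =>
      lift b to NNReal using ne_top_of_le_ne_top ENNReal.coe_ne_top hbn
      have h' : (a : ℝ) + n = b + p := by exact_mod_cast h
      have : ((a : ℝ) - b : ℝ) = (p : ℝ) - n := by linarith
      have h2 : (((a : ℝ) - b : ℝ) : EReal) = (((p : ℝ) - n : ℝ) : EReal) := by rw [this]
      simpa only [EReal.coe_nnreal_eq_coe_real, EReal.coe_sub] using h2

/-- The extended expectation may be computed from any decomposition of `f` as a difference
`P - N` of nonnegative functions, as soon as one of the two has finite integral. The relation
`f = P - N` is written additively, since `P` and `N` take values in `[0, ∞]`. -/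
theorem expectation_of_parts {f : Ω → ℝ} {P N : Ω → ℝ≥0∞} (hf : AEMeasurable f μ)
    (hP : AEMeasurable P μ) (hN : AEMeasurable N μ)
    (h : ∀ᵐ ω ∂μ, ENNReal.ofReal (f ω) + N ω = ENNReal.ofReal (-f ω) + P ω)
    (hPN : (∫⁻ ω, P ω ∂μ) ≠ ⊤ ∨ (∫⁻ ω, N ω ∂μ) ≠ ⊤) :
    ExpectationExists μ f ∧
      expectation μ f = ((∫⁻ ω, P ω ∂μ : ℝ≥0∞) : EReal) - ((∫⁻ ω, N ω ∂μ : ℝ≥0∞) : EReal) := by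
  have h1 : (∫⁻ ω, ENNReal.ofReal (f ω) ∂μ) ≤ ∫⁻ ω, P ω ∂μ := by
    refine lintegral_mono_ae (h.mono fun ω hω => ?_)
    rcases le_total (f ω) 0 with h0 | h0
    · simp [ENNReal.ofReal_of_nonpos h0]
    · rw [ENNReal.ofReal_of_nonpos (by linarith : -f ω ≤ 0), zero_add] at hω
      exact hω ▸ le_self_add
  have h2 : (∫⁻ ω, ENNReal.ofReal (-f ω) ∂μ) ≤ ∫⁻ ω, N ω ∂μ := by
    refine lintegral_mono_ae (h.mono fun ω hω => ?_)
    rcases le_total (f ω) 0 with h0 | h0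
    · rw [ENNReal.ofReal_of_nonpos h0, zero_add] at hω
      exact hω ▸ le_self_add
    · simp [ENNReal.ofReal_of_nonpos (by linarith : -f ω ≤ 0)]
  have h3 : (∫⁻ ω, ENNReal.ofReal (f ω) ∂μ) + ∫⁻ ω, N ω ∂μ
      = (∫⁻ ω, ENNReal.ofReal (-f ω) ∂μ) + ∫⁻ ω, P ω ∂μ := by
    rw [← lintegral_add_right' _ hN, ← lintegral_add_right' _ hP]
    exact lintegral_congr_ae h
  refine ⟨⟨hf, hPN.imp (ne_top_of_le_ne_top · h1) (ne_top_of_le_ne_top · h2)⟩, ?_⟩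
  exact ereal_sub_eq_of_add_eq_add h3 h1 h2 hPN

/-- `(x - y)⁺ - (x - y)⁻ = (x⁺ + y⁻) - (x⁻ + y⁺)`, written additively. -/
theorem ofReal_sub_add_eq (x y : ℝ) :
    ENNReal.ofReal (x - y) + (ENNReal.ofReal (-x) + ENNReal.ofReal y)
      = ENNReal.ofReal (-(x - y)) + (ENNReal.ofReal x + ENNReal.ofReal (-y)) := by
  simp only [ENNReal.ofReal]
  rw [← ENNReal.coe_add, ← ENNReal.coe_add, ← ENNReal.coe_add, ← ENNReal.coe_add,
    ENNReal.coe_inj, ← NNReal.coe_inj]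
  push_cast [Real.coe_toNNReal']
  have key : ∀ z : ℝ, max z 0 - max (-z) 0 = z := fun z => by
    rcases le_total z 0 with h | h
    · rw [max_eq_right h, max_eq_left (by linarith)]; ring
    · rw [max_eq_left h, max_eq_right (by linarith)]; ring
  linarith [key x, key y, key (x - y)]

/-- A determinate difference of two determinate differences may be regrouped. -/
theorem ereal_sub_sub_sub {a b c d : ℝ≥0∞} (hab : a ≠ ⊤ ∨ b ≠ ⊤) (hcd : c ≠ ⊤ ∨ d ≠ ⊤)
    (h : DiffDefined ((a : EReal) - b) ((c : EReal) - d)) :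
    (a + d ≠ ⊤ ∨ b + c ≠ ⊤) ∧
      ((a + d : ℝ≥0∞) : EReal) - ((b + c : ℝ≥0∞) : EReal)
        = ((a : EReal) - b) - ((c : EReal) - d) := by
  unfold DiffDefined at h
  induction a <;> induction b <;> induction c <;> induction d <;>
    simp [EReal.coe_ennreal_top, EReal.coe_nnreal_eq_coe_real, ← EReal.coe_sub,
      ← EReal.coe_add] at *
  ring

/-- Extended expectation is additive on determinate differences. -/
theorem expectation_sub {f h : Ω → ℝ} (hf : ExpectationExists μ f) (hh : ExpectationExists μ h)
    (hd : DiffDefined (expectation μ f) (expectation μ h)) :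
    ExpectationExists μ (fun ω => f ω - h ω) ∧
      expectation μ (fun ω => f ω - h ω) = expectation μ f - expectation μ h := by
  obtain ⟨hfm, hf⟩ := hf
  obtain ⟨hhm, hh⟩ := hh
  have e1 : (∫⁻ ω, (ENNReal.ofReal (f ω) + ENNReal.ofReal (-h ω)) ∂μ)
      = (∫⁻ ω, ENNReal.ofReal (f ω) ∂μ) + ∫⁻ ω, ENNReal.ofReal (-h ω) ∂μ :=
    lintegral_add_left' (by fun_prop) _
  have e2 : (∫⁻ ω, (ENNReal.ofReal (-f ω) + ENNReal.ofReal (h ω)) ∂μ)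
      = (∫⁻ ω, ENNReal.ofReal (-f ω) ∂μ) + ∫⁻ ω, ENNReal.ofReal (h ω) ∂μ :=
    lintegral_add_left' (by fun_prop) _
  have key := expectation_of_parts (μ := μ) (f := fun ω => f ω - h ω)
    (P := fun ω => ENNReal.ofReal (f ω) + ENNReal.ofReal (-h ω))
    (N := fun ω => ENNReal.ofReal (-f ω) + ENNReal.ofReal (h ω))
    (by fun_prop) (by fun_prop) (by fun_prop)
    (Filter.Eventually.of_forall fun ω => ofReal_sub_add_eq (f ω) (h ω))
  rw [e1, e2] at key
  obtain ⟨hfin, heq⟩ := ereal_sub_sub_sub hf hh hd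
  obtain ⟨hex, hval⟩ := key hfin
  exact ⟨hex, hval.trans heq⟩

end Expectation

/-! ### Densities under injective smooth maps -/

section ChangeOfVariables

variable {Ω : Type*} [MeasurableSpace Ω] {μ : Measure Ω}

theorem ae_pdf_pos_lt_top [IsFiniteMeasure μ] {E : Type*} [MeasurableSpace E] {ν : Measure E}
    (W : Ω → E)
    [HasPDF W μ ν] : ∀ᵐ ω ∂μ, 0 < pdf W μ ν (W ω) ∧ pdf W μ ν (W ω) < ⊤ := by
  have hW : AEMeasurable W μ := HasPDF.aemeasurable W μ ν
  have hac : μ.map W ≪ ν := HasPDF.absolutelyContinuous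
  have h1 : ∀ᵐ w ∂(μ.map W), 0 < pdf W μ ν w := Measure.rnDeriv_pos hac
  have h2 : ∀ᵐ w ∂(μ.map W), pdf W μ ν w < ⊤ :=
    hac.ae_le pdf.ae_lt_top
  exact (ae_of_ae_map hW h1).and (ae_of_ae_map hW h2)

/-- If the law of `Z` has a density and is carried by `U`, and `Φ` is injective and differentiable
on `U` with invertible derivative, then `W = Φ(Z)` has a density. -/
theorem hasPDF_of_injOn [IsFiniteMeasure μ] {E : Type*} [NormedAddCommGroup E] [NormedSpace ℝ E]
    [FiniteDimensional ℝ E] [MeasurableSpace E] [BorelSpace E] {ν : Measure E} [ν.IsAddHaarMeasure]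
    {Z W : Ω → E} (hZ : HasPDF Z μ ν) (hW : AEMeasurable W μ) {U : Set E} (hU : MeasurableSet U)
    (hZU : ∀ᵐ ω ∂μ, Z ω ∈ U) {Φ : E → E} {Φ' : E → E →L[ℝ] E}
    (hΦ : ∀ z ∈ U, HasFDerivWithinAt Φ (Φ' z) U z) (hinj : Set.InjOn Φ U)
    (hdet : ∀ z ∈ U, (Φ' z).det ≠ 0) (hWZ : ∀ᵐ ω ∂μ, W ω = Φ (Z ω)) :
    HasPDF W μ ν := by
  have hZm : AEMeasurable Z μ := HasPDF.aemeasurable Z μ ν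
  refine hasPDF_iff.mpr ⟨hW, inferInstance, ?_⟩
  refine Measure.AbsolutelyContinuous.mk fun N hN hN0 => ?_
  have hcont : ContinuousOn Φ U := fun z hz => (hΦ z hz).continuousWithinAt
  have hE : MeasurableSet (U ∩ Φ ⁻¹' N) := by
    classical
    have hp : Measurable (U.piecewise Φ fun _ => 0) :=
      hcont.measurable_piecewise continuousOn_const hU
    convert! hU.inter (hp hN) using 1
    ext z
    by_cases hz : z ∈ U <;> simp [hz]
  have himg : ν (Φ '' (U ∩ Φ ⁻¹' N)) = 0 :=
    measure_mono_null (by rintro _ ⟨z, hz, rfl⟩; exact hz.2) hN0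
  -- the image has measure `∫ |det Φ'|`, which vanishes only over a null set
  rw [← lintegral_abs_det_fderiv_eq_addHaar_image ν hE
    (fun z hz => (hΦ z hz.1).mono Set.inter_subset_left) (hinj.mono Set.inter_subset_left),
    lintegral_eq_zero_iff' (aemeasurable_ofReal_abs_det_fderivWithin ν hE
      (fun z hz => (hΦ z hz.1).mono Set.inter_subset_left)),
    Filter.EventuallyEq, ae_restrict_iff' hE] at himg
  have hac : μ.map Z ≪ ν := HasPDF.absolutelyContinuous
  rw [Measure.map_apply_of_aemeasurable hW hN, measure_eq_zero_iff_ae_notMem]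
  filter_upwards [hZU, hWZ, ae_of_ae_map hZm (hac.ae_le himg)] with ω h1 h2 h3 hN'
  have h4 := h3 ⟨h1, by rw [Set.mem_preimage, ← h2]; exact hN'⟩
  simp [hdet _ h1] at h4

/-- The change of variables formula for densities, evaluated at the random point. -/
theorem pdf_eq_abs_det_mul_pdf {E : Type*} [NormedAddCommGroup E] [NormedSpace ℝ E]
    [FiniteDimensional ℝ E] [MeasurableSpace E] [BorelSpace E] {ν : Measure E} [ν.IsAddHaarMeasure]
    {Z W : Ω → E} (hZ : HasPDF Z μ ν) (hW : HasPDF W μ ν) {U : Set E} (hU : MeasurableSet U)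
    (hZU : ∀ᵐ ω ∂μ, Z ω ∈ U) {Φ : E → E} {Φ' : E → E →L[ℝ] E}
    (hΦ : ∀ z ∈ U, HasFDerivWithinAt Φ (Φ' z) U z) (hinj : Set.InjOn Φ U)
    (hWZ : ∀ᵐ ω ∂μ, W ω = Φ (Z ω)) :
    ∀ᵐ ω ∂μ, pdf Z μ ν (Z ω) = ENNReal.ofReal |(Φ' (Z ω)).det| * pdf W μ ν (W ω) := by
  have hZm : AEMeasurable Z μ := HasPDF.aemeasurable Z μ ν
  have hWm : AEMeasurable W μ := HasPDF.aemeasurable W μ ν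
  have hcont : ContinuousOn Φ U := fun z hz => (hΦ z hz).continuousWithinAt
  have key : pdf Z μ ν =ᵐ[ν.restrict U]
      fun z => ENNReal.ofReal |(Φ' z).det| * pdf W μ ν (Φ z) := by
    have hm1 : AEMeasurable (fun z => ENNReal.ofReal |(Φ' z).det|) (ν.restrict U) :=
      aemeasurable_ofReal_abs_det_fderivWithin ν hU hΦ
    have hm2 : AEMeasurable (fun z => pdf W μ ν (Φ z)) (ν.restrict U) :=
      (measurable_pdf W μ ν).comp_aemeasurable (hcont.aemeasurable hU)
    refine ae_eq_of_forall_setLIntegral_eq_of_sigmaFinite₀ (measurable_pdf Z μ ν).aemeasurable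
      (hm1.mul hm2) fun s hs _ => ?_
    rw [Measure.restrict_restrict hs]
    have hsU : MeasurableSet (s ∩ U) := hs.inter hU
    have himg : MeasurableSet (Φ '' (s ∩ U)) :=
      measurable_image_of_fderivWithin hsU
        (fun z hz => (hΦ z hz.2).mono Set.inter_subset_right) (hinj.mono Set.inter_subset_right)
    rw [← map_eq_setLIntegral_pdf Z μ ν hsU,
      ← lintegral_image_eq_lintegral_abs_det_fderiv_mul ν hsU
        (fun z hz => (hΦ z hz.2).mono Set.inter_subset_right) (hinj.mono Set.inter_subset_right)
        (pdf W μ ν), ← map_eq_setLIntegral_pdf W μ ν himg,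
      Measure.map_apply_of_aemeasurable hZm hsU, Measure.map_apply_of_aemeasurable hWm himg]
    refine measure_congr ?_
    filter_upwards [hZU, hWZ] with ω h1 h2
    refine propext ⟨fun h => ⟨Z ω, h, h2.symm⟩, ?_⟩
    rintro ⟨z, hz, hzW⟩
    have : z = Z ω := hinj hz.2 h1 (hzW.trans h2)
    rw [this] at hz
    exact hz
  have hac : μ.map Z ≪ ν := HasPDF.absolutelyContinuous
  rw [Filter.EventuallyEq, ae_restrict_iff' hU] at key
  filter_upwards [hZU, hWZ, ae_of_ae_map hZm (hac.ae_le key)] with ω h1 h2 h3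
  rw [h2]
  exact h3 h1

theorem det_clm_real_prod (A : ℝ × ℝ →L[ℝ] ℝ × ℝ) :
    A.det = (A (1, 0)).1 * (A (0, 1)).2 - (A (0, 1)).1 * (A (1, 0)).2 := by
  rw [ContinuousLinearMap.det, ← LinearMap.det_toMatrix (Module.Basis.finTwoProd ℝ),
    Matrix.det_fin_two]
  simp [LinearMap.toMatrix_apply]

theorem dX_eq_fderiv {g : ℝ × ℝ → ℝ} {z : ℝ × ℝ} (hg : DifferentiableAt ℝ g z) :
    dX g z = fderiv ℝ g z (1, 0) := by
  have h1 : HasDerivAt (fun s : ℝ => (s, z.2)) ((1 : ℝ), (0 : ℝ)) z.1 :=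
    (hasDerivAt_id z.1).prodMk (hasDerivAt_const z.1 z.2)
  exact (HasFDerivAt.comp_hasDerivAt z.1 (f := fun s : ℝ => (s, z.2)) hg.hasFDerivAt h1).deriv

theorem dY_eq_fderiv {g : ℝ × ℝ → ℝ} {z : ℝ × ℝ} (hg : DifferentiableAt ℝ g z) :
    dY g z = fderiv ℝ g z (0, 1) := by
  have h1 : HasDerivAt (fun s : ℝ => (z.1, s)) ((0 : ℝ), (1 : ℝ)) z.2 :=
    (hasDerivAt_const z.2 z.1).prodMk (hasDerivAt_id z.2)
  exact (HasFDerivAt.comp_hasDerivAt z.2 (f := fun s : ℝ => (z.1, s)) hg.hasFDerivAt h1).deriv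

theorem dens_pos [IsFiniteMeasure μ] (W : Ω → ℝ) [HasPDF W μ volume] :
    ∀ᵐ ω ∂μ, 0 < dens μ W (W ω) :=
  (ae_pdf_pos_lt_top (μ := μ) (ν := volume) W).mono fun _ h =>
    ENNReal.toReal_pos h.1.ne' h.2.ne

variable {X Y T : Ω → ℝ} {g : ℝ × ℝ → ℝ}

theorem hasPDF_marginals [IsFiniteMeasure μ] {V W : Ω → ℝ}
    (h : HasPDF (fun ω => (V ω, W ω)) μ volume) : HasPDF V μ volume ∧ HasPDF W μ volume :=
  ⟨pdf.quasiMeasurePreserving_hasPDF' (μ := (volume : Measure (ℝ × ℝ))) (g := Prod.fst)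
      (fun ω => (V ω, W ω)) Measure.quasiMeasurePreserving_fst,
    pdf.quasiMeasurePreserving_hasPDF' (μ := (volume : Measure (ℝ × ℝ))) (g := Prod.snd)
      (fun ω => (V ω, W ω)) Measure.quasiMeasurePreserving_snd⟩

/-- `(X, T)` has a density, and `p_{X,Y}(X, Y) = |∂_y g| p_{X,T}(X, T)`. -/
theorem hasPDF_fst_target [IsFiniteMeasure μ] (hI : IsNFBI μ X Y T g)
    (hW : IsWellBehaved μ X Y g) :
    HasPDF (fun ω => (X ω, T ω)) μ volume ∧
      ∀ᵐ ω ∂μ, pdf (fun ω => (X ω, Y ω)) μ volume (X ω, Y ω)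
        = ENNReal.ofReal |dY g (X ω, Y ω)|
          * pdf (fun ω => (X ω, T ω)) μ volume (X ω, T ω) := by
  obtain ⟨U, hU, hZU, hg, hd, hinjY, -⟩ := hW
  have hdiff : ∀ z ∈ U, DifferentiableAt ℝ g z := fun z hz =>
    (hg.differentiableOn one_ne_zero).differentiableAt (hU.mem_nhds hz)
  have hΦ : ∀ z ∈ U, HasFDerivWithinAt (fun z : ℝ × ℝ => (z.1, g z))
      ((ContinuousLinearMap.fst ℝ ℝ ℝ).prod (fderiv ℝ g z)) U z := fun z hz =>
    (hasFDerivAt_fst.prodMk (hdiff z hz).hasFDerivAt).hasFDerivWithinAt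
  have hdet : ∀ z ∈ U, ((ContinuousLinearMap.fst ℝ ℝ ℝ).prod (fderiv ℝ g z)).det = dY g z :=
    fun z hz => by rw [det_clm_real_prod, dY_eq_fderiv (hdiff z hz)]; simp
  have hinj : Set.InjOn (fun z : ℝ × ℝ => (z.1, g z)) U := by
    rintro ⟨x, y⟩ hz ⟨x', y'⟩ hz' h
    obtain ⟨rfl, h2⟩ := Prod.mk.inj h
    exact congrArg (Prod.mk x) (hinjY x hz hz' h2)
  have hWZ : ∀ᵐ ω ∂μ, (X ω, T ω) = (fun z : ℝ × ℝ => (z.1, g z)) (X ω, Y ω) :=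
    ae_of_all _ fun ω => by simp [hI.eq_kernel ω]
  have hpdf : HasPDF (fun ω => (X ω, T ω)) μ volume :=
    hasPDF_of_injOn hI.hasPDF (hI.measurable_X.prodMk hI.measurable_T).aemeasurable
      hU.measurableSet hZU hΦ hinj (fun z hz => by rw [hdet z hz]; exact abs_pos.mp (hd z hz).2) hWZ
  refine ⟨hpdf, ?_⟩
  filter_upwards [hZU, pdf_eq_abs_det_mul_pdf hI.hasPDF hpdf hU.measurableSet hZU hΦ hinj hWZ]
    with ω h1 h2
  rw [h2, hdet _ h1]

/-- `(Y, T)` has a density, and `p_{X,Y}(X, Y) = |∂ₓ g| p_{Y,T}(Y, T)`. -/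
theorem hasPDF_snd_target [IsFiniteMeasure μ] (hI : IsNFBI μ X Y T g)
    (hW : IsWellBehaved μ X Y g) :
    HasPDF (fun ω => (Y ω, T ω)) μ volume ∧
      ∀ᵐ ω ∂μ, pdf (fun ω => (X ω, Y ω)) μ volume (X ω, Y ω)
        = ENNReal.ofReal |dX g (X ω, Y ω)|
          * pdf (fun ω => (Y ω, T ω)) μ volume (Y ω, T ω) := by
  obtain ⟨U, hU, hZU, hg, hd, -, hinjX⟩ := hW
  have hdiff : ∀ z ∈ U, DifferentiableAt ℝ g z := fun z hz =>
    (hg.differentiableOn one_ne_zero).differentiableAt (hU.mem_nhds hz)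
  have hΦ : ∀ z ∈ U, HasFDerivWithinAt (fun z : ℝ × ℝ => (z.2, g z))
      ((ContinuousLinearMap.snd ℝ ℝ ℝ).prod (fderiv ℝ g z)) U z := fun z hz =>
    (hasFDerivAt_snd.prodMk (hdiff z hz).hasFDerivAt).hasFDerivWithinAt
  have hdet : ∀ z ∈ U, ((ContinuousLinearMap.snd ℝ ℝ ℝ).prod (fderiv ℝ g z)).det = -dX g z :=
    fun z hz => by rw [det_clm_real_prod, dX_eq_fderiv (hdiff z hz)]; simp
  have hinj : Set.InjOn (fun z : ℝ × ℝ => (z.2, g z)) U := by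
    rintro ⟨x, y⟩ hz ⟨x', y'⟩ hz' h
    obtain ⟨rfl, h2⟩ := Prod.mk.inj h
    exact congrArg (Prod.mk · y) (hinjX y hz hz' h2)
  have hWZ : ∀ᵐ ω ∂μ, (Y ω, T ω) = (fun z : ℝ × ℝ => (z.2, g z)) (X ω, Y ω) :=
    ae_of_all _ fun ω => by simp [hI.eq_kernel ω]
  have hpdf : HasPDF (fun ω => (Y ω, T ω)) μ volume :=
    hasPDF_of_injOn hI.hasPDF (hI.measurable_Y.prodMk hI.measurable_T).aemeasurable
      hU.measurableSet hZU hΦ hinj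
      (fun z hz => by rw [hdet z hz]; exact neg_ne_zero.mpr <| abs_pos.mp (hd z hz).1)
      hWZ
  refine ⟨hpdf, ?_⟩
  filter_upwards [hZU, pdf_eq_abs_det_mul_pdf hI.hasPDF hpdf hU.measurableSet hZU hΦ hinj hWZ]
    with ω h1 h2
  rw [h2, hdet _ h1, abs_neg]

/-- The quotient of the conditional densities is the quotient of the partial derivatives:
`|∂_y g| p_{X|T}(X|T) = |∂ₓ g| p_{Y|T}(Y|T)`, all factors being positive. -/
theorem ae_abs_dY_mul_condDens_eq [IsFiniteMeasure μ] (hI : IsNFBI μ X Y T g)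
    (hW : IsWellBehaved μ X Y g) :
    ∀ᵐ ω ∂μ, (0 < |dX g (X ω, Y ω)| ∧ 0 < |dY g (X ω, Y ω)|) ∧
      (0 < condDens μ X T (X ω) (T ω) ∧ 0 < condDens μ Y T (Y ω) (T ω)) ∧
      |dY g (X ω, Y ω)| * condDens μ X T (X ω) (T ω)
        = |dX g (X ω, Y ω)| * condDens μ Y T (Y ω) (T ω) := by
  obtain ⟨hXT, eX⟩ := hasPDF_fst_target hI hW
  obtain ⟨hYT, eY⟩ := hasPDF_snd_target hI hW
  obtain ⟨-, hT⟩ := hasPDF_marginals hXT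
  obtain ⟨U, -, hZU, -, hd, -⟩ := hW
  filter_upwards [hZU, eX, eY, ae_pdf_pos_lt_top (μ := μ) (ν := volume) fun ω => (X ω, T ω),
    ae_pdf_pos_lt_top (μ := μ) (ν := volume) fun ω => (Y ω, T ω), dens_pos (μ := μ) T]
    with ω h1 h2 h3 h4 h5 ht
  refine ⟨hd _ h1, ⟨div_pos (ENNReal.toReal_pos h4.1.ne' h4.2.ne) ht,
    div_pos (ENNReal.toReal_pos h5.1.ne' h5.2.ne) ht⟩, ?_⟩
  have h := congrArg ENNReal.toReal (h2.symm.trans h3)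
  rw [condDens, condDens, ← mul_div_assoc, ← mul_div_assoc]
  simpa only [ENNReal.toReal_mul, ENNReal.toReal_ofReal (abs_nonneg _)]
    using congrArg (· / dens μ T (T ω)) h

end ChangeOfVariables

/-! ### Specific and mutual information as extended expectations -/

section Information

/-- `klFun ρ = ρ log⁺ ρ - ρ log⁻ ρ + 1 - ρ`, written additively. -/
theorem klFun_parts {ρ : ℝ} (hρ : 0 ≤ ρ) :
    ENNReal.ofReal (klFun ρ) + ENNReal.ofReal ρ + ENNReal.ofReal ρ * ENNReal.ofReal (-Real.log ρ)
      = ENNReal.ofReal ρ * ENNReal.ofReal (Real.log ρ) + 1 := by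
  have h0 := klFun_nonneg hρ
  rcases le_total (Real.log ρ) 0 with h | h
  · rw [ENNReal.ofReal_of_nonpos h, mul_zero, zero_add, ← ENNReal.ofReal_mul hρ,
      ← ENNReal.ofReal_add h0 hρ, ← ENNReal.ofReal_add (by positivity)
        (mul_nonneg hρ (by linarith)), ← ENNReal.ofReal_one]
    congr 1
    rw [klFun]; ring
  · rw [ENNReal.ofReal_of_nonpos (by linarith : -Real.log ρ ≤ 0), mul_zero, add_zero,
      ← ENNReal.ofReal_mul hρ, ← ENNReal.ofReal_add h0 hρ, ← ENNReal.ofReal_one,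
      ← ENNReal.ofReal_add (mul_nonneg hρ h) zero_le_one]
    congr 1
    rw [klFun]; ring

/-- The negative part of the log-likelihood ratio is integrable, with a universal bound: this is
why a divergence may be infinite but is never indeterminate. -/
theorem lintegral_neg_llr_le {α : Type*} [MeasurableSpace α] (P Q : Measure α)
    [IsProbabilityMeasure P] [IsProbabilityMeasure Q] (h : P ≪ Q) :
    ∫⁻ x, ENNReal.ofReal (-llr P Q x) ∂P ≤ 1 := by
  rw [← lintegral_rnDeriv_mul h (by fun_prop)]
  calc ∫⁻ x, P.rnDeriv Q x * ENNReal.ofReal (-llr P Q x) ∂Q ≤ ∫⁻ _, 1 ∂Q := by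
        refine lintegral_mono_ae ((P.rnDeriv_lt_top Q).mono fun x hx => ?_)
        rw [llr, ← ENNReal.ofReal_toReal hx.ne, ENNReal.toReal_ofReal ENNReal.toReal_nonneg,
          ← ENNReal.ofReal_mul ENNReal.toReal_nonneg, ← ENNReal.ofReal_one]
        refine ENNReal.ofReal_le_ofReal ?_
        have h0 := klFun_nonneg (ENNReal.toReal_nonneg (a := P.rnDeriv Q x))
        rw [klFun] at h0
        have h1 := ENNReal.toReal_nonneg (a := P.rnDeriv Q x)
        linarith
    _ = 1 := by simp

/-- The divergence is the difference of the integrals of the positive and negative parts of the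
log-likelihood ratio, also when it is infinite. -/
theorem klDiv_add_lintegral_neg_llr {α : Type*} [MeasurableSpace α] (P Q : Measure α)
    [IsProbabilityMeasure P] [IsProbabilityMeasure Q] (h : P ≪ Q) :
    klDiv P Q + ∫⁻ x, ENNReal.ofReal (-llr P Q x) ∂P = ∫⁻ x, ENNReal.ofReal (llr P Q x) ∂P := by
  have hm : Measurable (llr P Q) := measurable_llr P Q
  have hr : Measurable (P.rnDeriv Q) := Measure.measurable_rnDeriv P Q
  -- add `1 = ∫ dP/dQ dQ = ∫ 1 dQ` to both sides, to compare the integrands with respect to `Q`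
  refine (ENNReal.add_left_inj ENNReal.one_ne_top).mp ?_
  rw [klDiv_eq_lintegral_klFun_of_ac h, ← lintegral_rnDeriv_mul h (by fun_prop),
    ← lintegral_rnDeriv_mul h (by fun_prop)]
  have h1 : (1 : ℝ≥0∞) = ∫⁻ x, P.rnDeriv Q x ∂Q := by
    rw [Measure.lintegral_rnDeriv h, measure_univ]
  have h2 : (1 : ℝ≥0∞) = ∫⁻ _, 1 ∂Q := by simp
  conv_lhs => rw [add_right_comm, h1]
  conv_rhs => rw [h2]
  rw [← lintegral_add_right _ hr, ← lintegral_add_right _ (by fun_prop),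
    ← lintegral_add_right _ measurable_const]
  refine lintegral_congr_ae ((P.rnDeriv_lt_top Q).mono fun x hx => ?_)
  have := klFun_parts (ENNReal.toReal_nonneg (a := P.rnDeriv Q x))
  rw [ENNReal.ofReal_toReal hx.ne] at this
  exact this

variable {Ω : Type*} [MeasurableSpace Ω] {μ : Measure Ω}

theorem map_prod_map_eq_withDensity [SFinite μ] {V W : Ω → ℝ} (hV : HasPDF V μ volume)
    (hW : HasPDF W μ volume) :
    (μ.map V).prod (μ.map W) = (volume : Measure (ℝ × ℝ)).withDensity
      fun z => pdf V μ volume z.1 * pdf W μ volume z.2 := by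
  rw [map_eq_withDensity_pdf V μ volume, map_eq_withDensity_pdf W μ volume,
    prod_withDensity (measurable_pdf V μ volume) (measurable_pdf W μ volume),
    Measure.volume_eq_prod]

variable {X T : Ω → ℝ}

/-- The pointwise mutual information `log (p_{X|T}(X|T) / p_X(X))`. -/
noncomputable def pointInfo (b : ℝ) (μ : Measure Ω) (T X : Ω → ℝ) (ω : Ω) : ℝ :=
  Real.logb b (condDens μ X T (X ω) (T ω) / dens μ X (X ω))

theorem measurable_condDens_comp (hX : Measurable X) (hT : Measurable T) :
    Measurable fun ω => condDens μ X T (X ω) (T ω) :=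
  ((measurable_pdf _ μ volume).comp (hX.prodMk hT)).ennreal_toReal.div
    ((measurable_pdf T μ volume).comp hT).ennreal_toReal

theorem measurable_dens_comp (hX : Measurable X) : Measurable fun ω => dens μ X (X ω) :=
  ((measurable_pdf X μ volume).comp hX).ennreal_toReal

theorem measurable_pointInfo (b : ℝ) (hX : Measurable X) (hT : Measurable T) :
    Measurable (pointInfo b μ T X) :=
  ((measurable_condDens_comp hX hT).div (measurable_dens_comp hX)).log.div_const _

variable [IsProbabilityMeasure μ]

theorem pdf_prod_swap {V W : Ω → ℝ} (h : HasPDF (fun ω => (V ω, W ω)) μ volume) :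
    HasPDF (fun ω => (W ω, V ω)) μ volume ∧
      ∀ᵐ ω ∂μ, pdf (fun ω => (V ω, W ω)) μ volume (V ω, W ω)
        = pdf (fun ω => (W ω, V ω)) μ volume (W ω, V ω) := by
  let L : ℝ × ℝ →L[ℝ] ℝ × ℝ :=
    (ContinuousLinearMap.snd ℝ ℝ ℝ).prod (ContinuousLinearMap.fst ℝ ℝ ℝ)
  have hdet : L.det = -1 := by rw [det_clm_real_prod]; simp [L]
  have hL : ∀ z ∈ (Set.univ : Set (ℝ × ℝ)), HasFDerivWithinAt L L Set.univ z :=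
    fun z _ => L.hasFDerivAt.hasFDerivWithinAt
  have hinj : Set.InjOn L Set.univ := by
    rintro ⟨a, b⟩ - ⟨c, d⟩ - h
    simpa [L, and_comm] using h
  have hm := HasPDF.aemeasurable (fun ω => (V ω, W ω)) μ volume
  have hpdf : HasPDF (fun ω => (W ω, V ω)) μ volume :=
    hasPDF_of_injOn h (hm.snd.prodMk hm.fst) MeasurableSet.univ (by simp) hL hinj
      (by simp [hdet]) (ae_of_all _ fun ω => rfl)
  refine ⟨hpdf, ?_⟩
  filter_upwards [pdf_eq_abs_det_mul_pdf h hpdf MeasurableSet.univ (by simp) hL hinj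
    (ae_of_all _ fun ω => rfl)] with ω hω
  simpa [hdet] using hω

theorem map_prodMk_absolutelyContinuous {V W : Ω → ℝ}
    (h : HasPDF (fun ω => (V ω, W ω)) μ volume) :
    μ.map (fun ω => (V ω, W ω)) ≪ (μ.map V).prod (μ.map W) := by
  obtain ⟨hV, hW⟩ := hasPDF_marginals h
  have hm := HasPDF.aemeasurable (fun ω => (V ω, W ω)) μ volume
  have hac : μ.map (fun ω => (V ω, W ω)) ≪ volume := HasPDF.absolutelyContinuous
  have hmd : Measurable fun z : ℝ × ℝ => pdf V μ volume z.1 * pdf W μ volume z.2 :=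
    ((measurable_pdf V μ volume).comp measurable_fst).mul
      ((measurable_pdf W μ volume).comp measurable_snd)
  rw [map_prod_map_eq_withDensity hV hW]
  refine Measure.AbsolutelyContinuous.mk fun N hN hN0 => ?_
  rw [withDensity_apply _ hN, lintegral_eq_zero_iff hmd, Filter.EventuallyEq,
    ae_restrict_iff' hN] at hN0
  rw [Measure.map_apply_of_aemeasurable hm hN, measure_eq_zero_iff_ae_notMem]
  filter_upwards [ae_of_ae_map hm (hac.ae_le hN0), ae_pdf_pos_lt_top (μ := μ) (ν := volume) V,
    ae_pdf_pos_lt_top (μ := μ) (ν := volume) W] with ω h1 h2 h3 h4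
  have := h1 h4
  simp [h2.1.ne', h3.1.ne'] at this

/-- A jointly measurable version of the density of `P_{X|T=t}` with respect to `P_X`: the kernel
Radon-Nikodym derivative of the conditional distribution with respect to the constant kernel. -/
noncomputable def condRatio (μ : Measure Ω) [IsProbabilityMeasure μ] (X T : Ω → ℝ) (t x : ℝ) :
    ℝ≥0∞ :=
  Kernel.rnDeriv (condDistrib X T μ) (Kernel.const ℝ (μ.map X)) t x

theorem measurable_condRatio : Measurable fun z : ℝ × ℝ => condRatio μ X T z.1 z.2 :=
  Kernel.measurable_rnDeriv _ _

theorem ae_condDistrib_ac (hXT : HasPDF (fun ω => (T ω, X ω)) μ volume) (hX : Measurable X) :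
    ∀ᵐ t ∂(μ.map T), condDistrib X T μ t ≪ μ.map X := by
  have h := map_prodMk_absolutelyContinuous hXT
  have : IsProbabilityMeasure (μ.map X) := Measure.isProbabilityMeasure_map hX.aemeasurable
  rw [← compProd_map_condDistrib hX.aemeasurable, ← Measure.compProd_const] at h
  exact h.kernel_of_compProd

theorem map_prodMk_eq_withDensity_condRatio (hXT : HasPDF (fun ω => (T ω, X ω)) μ volume)
    (hX : Measurable X) :
    μ.map (fun ω => (T ω, X ω)) = ((μ.map T).prod (μ.map X)).withDensity
      fun z => condRatio μ X T z.1 z.2 := by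
  have : IsProbabilityMeasure (μ.map X) := Measure.isProbabilityMeasure_map hX.aemeasurable
  rw [← compProd_map_condDistrib hX.aemeasurable, ← Measure.compProd_const]
  unfold condRatio
  rw [← Measure.compProd_withDensity (Kernel.measurable_rnDeriv _ _)]
  refine Measure.compProd_congr ?_
  filter_upwards [ae_condDistrib_ac hXT hX] with t ht
  exact (Kernel.withDensity_rnDeriv_eq ht).symm

/-- The density of `P_{X|T}` with respect to `P_X` is the quotient of the Lebesgue densities. -/
theorem ae_condRatio_eq (hXT : HasPDF (fun ω => (X ω, T ω)) μ volume) (hX : Measurable X) :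
    ∀ᵐ ω ∂μ, (condRatio μ X T (T ω) (X ω)).toReal
      = condDens μ X T (X ω) (T ω) / dens μ X (X ω) := by
  obtain ⟨hTX, hsw⟩ := pdf_prod_swap hXT
  obtain ⟨hT, hX'⟩ := hasPDF_marginals hTX
  have hm := HasPDF.aemeasurable (fun ω => (T ω, X ω)) μ volume
  have hac : μ.map (fun ω => (T ω, X ω)) ≪ volume := HasPDF.absolutelyContinuous
  have hmd : Measurable fun z : ℝ × ℝ => pdf T μ volume z.1 * pdf X μ volume z.2 :=
    ((measurable_pdf T μ volume).comp measurable_fst).mul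
      ((measurable_pdf X μ volume).comp measurable_snd)
  have h := map_prodMk_eq_withDensity_condRatio hTX hX
  rw [map_prod_map_eq_withDensity hT hX', ← withDensity_mul _ hmd measurable_condRatio] at h
  have h' := (pdf.eq_of_map_eq_withDensity _
    (hmd.mul measurable_condRatio).aemeasurable).mp h
  filter_upwards [hsw, ae_of_ae_map hm (hac.ae_le h'), dens_pos (μ := μ) X, dens_pos (μ := μ) T]
    with ω h1 h2 h3 h4
  rw [condDens, h1, h2]
  simp only [Pi.mul_apply, ENNReal.toReal_mul]
  change _ = dens μ T (T ω) * dens μ X (X ω) * _ / dens μ T (T ω) / dens μ X (X ω)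
  field_simp

theorem ae_llr_condDistrib (hXT : HasPDF (fun ω => (T ω, X ω)) μ volume) (hX : Measurable X) :
    ∀ᵐ t ∂(μ.map T), ∀ᵐ x ∂(condDistrib X T μ t),
      llr (condDistrib X T μ t) (μ.map X) x = Real.log (condRatio μ X T t x).toReal := by
  have : IsProbabilityMeasure (μ.map X) := Measure.isProbabilityMeasure_map hX.aemeasurable
  filter_upwards [ae_condDistrib_ac hXT hX] with t ht
  have h : condRatio μ X T t =ᵐ[μ.map X] (condDistrib X T μ t).rnDeriv (μ.map X) :=
    Kernel.rnDeriv_eq_rnDeriv_measure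
  filter_upwards [ht.ae_le h] with x hx
  rw [llr, hx]

theorem ae_llr_map_prodMk (hXT : HasPDF (fun ω => (T ω, X ω)) μ volume) (hX : Measurable X)
    (hT : Measurable T) :
    ∀ᵐ ω ∂μ, llr (μ.map fun ω => (T ω, X ω)) ((μ.map T).prod (μ.map X)) (T ω, X ω)
      = Real.log (condRatio μ X T (T ω) (X ω)).toReal := by
  have h := Measure.rnDeriv_withDensity ((μ.map T).prod (μ.map X))
    (measurable_condRatio (μ := μ) (X := X) (T := T))
  rw [← map_prodMk_eq_withDensity_condRatio hXT hX] at h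
  filter_upwards [ae_of_ae_map (hT.prodMk hX).aemeasurable
    ((map_prodMk_absolutelyContinuous hXT).ae_le h)] with ω hω
  rw [llr, hω]

theorem ae_pointInfo_eq (b : ℝ) (hXT : HasPDF (fun ω => (X ω, T ω)) μ volume)
    (hX : Measurable X) :
    ∀ᵐ ω ∂μ, pointInfo b μ T X ω
      = Real.logb b (Real.exp 1) * Real.log (condRatio μ X T (T ω) (X ω)).toReal := by
  filter_upwards [ae_condRatio_eq hXT hX] with ω hω
  rw [pointInfo, ← hω, Real.logb, Real.logb, Real.log_exp]
  ring

theorem setLIntegral_condDistrib_comp (hX : Measurable X) (hT : Measurable T)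
    {φ : ℝ → ℝ → ℝ≥0∞} (hφ : Measurable (Function.uncurry φ)) {S : Set ℝ} (hS : MeasurableSet S) :
    ∫⁻ ω in T ⁻¹' S, φ (T ω) (X ω) ∂μ
      = ∫⁻ t in S, ∫⁻ x, φ t x ∂(condDistrib X T μ t) ∂(μ.map T) := by
  have h1 : ∫⁻ ω in T ⁻¹' S, φ (T ω) (X ω) ∂μ
      = ∫⁻ z in S ×ˢ Set.univ, Function.uncurry φ z ∂(μ.map fun ω => (T ω, X ω)) := by
    rw [setLIntegral_map (hS.prod MeasurableSet.univ) hφ (hT.prodMk hX)]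
    have hpre : (fun ω => (T ω, X ω)) ⁻¹' (S ×ˢ Set.univ) = T ⁻¹' S := by ext ω; simp
    rw [hpre]
    rfl
  rw [h1, ← compProd_map_condDistrib hX.aemeasurable,
    Measure.setLIntegral_compProd hφ hS MeasurableSet.univ]
  simp

/-- The positive and negative parts of the conditional expectation of the pointwise information
given `T = t` differ by the specific information at `t`. -/
theorem ae_specificInfo_add (b : ℝ) (hb : 1 < b) (hTX : HasPDF (fun ω => (T ω, X ω)) μ volume)
    (hX : Measurable X) :
    ∀ᵐ t ∂(μ.map T),
      specificInfo b μ X T t + ∫⁻ x, ENNReal.ofReal (-(Real.logb b (Real.exp 1)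
          * Real.log (condRatio μ X T t x).toReal)) ∂(condDistrib X T μ t)
        = ∫⁻ x, ENNReal.ofReal (Real.logb b (Real.exp 1)
          * Real.log (condRatio μ X T t x).toReal) ∂(condDistrib X T μ t) ∧
      ∫⁻ x, ENNReal.ofReal (-(Real.logb b (Real.exp 1)
          * Real.log (condRatio μ X T t x).toReal)) ∂(condDistrib X T μ t)
        ≤ ENNReal.ofReal (Real.logb b (Real.exp 1)) := by
  have : IsProbabilityMeasure (μ.map X) := Measure.isProbabilityMeasure_map hX.aemeasurable
  have hc : 0 ≤ Real.logb b (Real.exp 1) :=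
    Real.logb_nonneg hb (Real.one_le_exp zero_le_one)
  have hr : Measurable fun z : ℝ × ℝ => condRatio μ X T z.1 z.2 := measurable_condRatio
  filter_upwards [ae_condDistrib_ac hTX hX, ae_llr_condDistrib hTX hX] with t ht hl
  have e1 : ∫⁻ x, ENNReal.ofReal (-(Real.logb b (Real.exp 1)
      * Real.log (condRatio μ X T t x).toReal)) ∂(condDistrib X T μ t)
      = ENNReal.ofReal (Real.logb b (Real.exp 1)) * ∫⁻ x, ENNReal.ofReal
        (-llr (condDistrib X T μ t) (μ.map X) x) ∂(condDistrib X T μ t) := by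
    rw [← lintegral_const_mul' _ _ ENNReal.ofReal_ne_top]
    refine lintegral_congr_ae (hl.mono fun x hx => ?_)
    simp only [hx, ← ENNReal.ofReal_mul hc, mul_neg]
  have e2 : ∫⁻ x, ENNReal.ofReal (Real.logb b (Real.exp 1)
      * Real.log (condRatio μ X T t x).toReal) ∂(condDistrib X T μ t)
      = ENNReal.ofReal (Real.logb b (Real.exp 1)) * ∫⁻ x, ENNReal.ofReal
        (llr (condDistrib X T μ t) (μ.map X) x) ∂(condDistrib X T μ t) := by
    rw [← lintegral_const_mul' _ _ ENNReal.ofReal_ne_top]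
    refine lintegral_congr_ae (hl.mono fun x hx => ?_)
    simp only [hx, ← ENNReal.ofReal_mul hc]
  rw [e1, e2, specificInfo, ← mul_add, klDiv_add_lintegral_neg_llr _ _ ht]
  exact ⟨rfl, (mul_le_mul_right (lintegral_neg_llr_le _ _ ht) _).trans_eq (mul_one _)⟩

theorem measurable_logRatio (c : ℝ) : Measurable (Function.uncurry fun t x : ℝ =>
    ENNReal.ofReal (c * Real.log (condRatio μ X T t x).toReal)) :=
  (measurable_condRatio.ennreal_toReal.log.const_mul c).ennreal_ofReal

theorem measurable_neg_logRatio (c : ℝ) : Measurable (Function.uncurry fun t x : ℝ =>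
    ENNReal.ofReal (-(c * Real.log (condRatio μ X T t x).toReal))) :=
  (measurable_condRatio.ennreal_toReal.log.const_mul c).neg.ennreal_ofReal

theorem aemeasurable_specificInfo (b : ℝ) (hb : 1 < b)
    (hTX : HasPDF (fun ω => (T ω, X ω)) μ volume) (hX : Measurable X) :
    AEMeasurable (specificInfo b μ X T) (μ.map T) := by
  have h1 := (measurable_logRatio (μ := μ) (X := X) (T := T)
    (Real.logb b (Real.exp 1))).lintegral_kernel_prod_right (κ := condDistrib X T μ)
  have h2 := (measurable_neg_logRatio (μ := μ) (X := X) (T := T)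
    (Real.logb b (Real.exp 1))).lintegral_kernel_prod_right (κ := condDistrib X T μ)
  refine (h1.sub h2).aemeasurable.congr ?_
  filter_upwards [ae_specificInfo_add b hb hTX hX] with t ht
  exact (ENNReal.eq_sub_of_add_eq (ne_top_of_le_ne_top ENNReal.ofReal_ne_top ht.2) ht.1).symm

theorem lintegral_neg_pointInfo_ne_top (b : ℝ) (hb : 1 < b)
    (hXT : HasPDF (fun ω => (X ω, T ω)) μ volume) (hX : Measurable X) (hT : Measurable T) :
    ∫⁻ ω, ENNReal.ofReal (-pointInfo b μ T X ω) ∂μ ≠ ⊤ := by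
  have : IsProbabilityMeasure (μ.map T) := Measure.isProbabilityMeasure_map hT.aemeasurable
  have h := setLIntegral_condDistrib_comp (μ := μ) hX hT
    (measurable_neg_logRatio (μ := μ) (X := X) (T := T) (Real.logb b (Real.exp 1)))
    MeasurableSet.univ
  simp only [Set.preimage_univ, Measure.restrict_univ] at h
  rw [lintegral_congr_ae ((ae_pointInfo_eq b hXT hX).mono fun ω hω =>
    congrArg (fun x => ENNReal.ofReal (-x)) hω), h]
  refine ne_top_of_le_ne_top (ENNReal.ofReal_ne_top (r := Real.logb b (Real.exp 1)))
    ((lintegral_mono_ae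
    ((ae_specificInfo_add b hb (pdf_prod_swap hXT).1 hX).mono fun t ht => ht.2)).trans_eq
      (by simp))

/-- The specific information, integrated over an event `{T ∈ S}`, is the expectation over that
event of the pointwise information. -/
theorem setLIntegral_specificInfo_add (b : ℝ) (hb : 1 < b)
    (hXT : HasPDF (fun ω => (X ω, T ω)) μ volume) (hX : Measurable X) (hT : Measurable T)
    {S : Set ℝ} (hS : MeasurableSet S) :
    (∫⁻ ω in T ⁻¹' S, specificInfo b μ X T (T ω) ∂μ)
        + ∫⁻ ω in T ⁻¹' S, ENNReal.ofReal (-pointInfo b μ T X ω) ∂μ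
      = ∫⁻ ω in T ⁻¹' S, ENNReal.ofReal (pointInfo b μ T X ω) ∂μ := by
  have hTX := (pdf_prod_swap hXT).1
  have hae := ae_restrict_of_ae (s := T ⁻¹' S) (ae_pointInfo_eq b hXT hX)
  have hsm := aemeasurable_specificInfo b hb hTX hX
  rw [lintegral_congr_ae (hae.mono fun ω hω => congrArg (fun x => ENNReal.ofReal (-x)) hω),
    lintegral_congr_ae (hae.mono fun ω hω => congrArg ENNReal.ofReal hω),
    setLIntegral_condDistrib_comp hX hT (measurable_neg_logRatio _) hS,
    setLIntegral_condDistrib_comp hX hT (measurable_logRatio _) hS,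
    ← lintegral_map' (Measure.restrict_map hT hS ▸ hsm.restrict) hT.aemeasurable,
    ← Measure.restrict_map hT hS, ← lintegral_add_left' hsm.restrict]
  exact lintegral_congr_ae (ae_restrict_of_ae
    ((ae_specificInfo_add b hb hTX hX).mono fun t ht => ht.1))

/-- Mutual information is the extended expectation of the pointwise information. -/
theorem mutualInfo_add (b : ℝ) (hb : 1 < b)
    (hXT : HasPDF (fun ω => (X ω, T ω)) μ volume) (hX : Measurable X) (hT : Measurable T) :
    mutualInfo b μ T X + ∫⁻ ω, ENNReal.ofReal (-pointInfo b μ T X ω) ∂μ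
      = ∫⁻ ω, ENNReal.ofReal (pointInfo b μ T X ω) ∂μ := by
  have hTX := (pdf_prod_swap hXT).1
  have hc : 0 ≤ Real.logb b (Real.exp 1) :=
    Real.logb_nonneg hb (Real.one_le_exp zero_le_one)
  have : IsProbabilityMeasure (μ.map X) := Measure.isProbabilityMeasure_map hX.aemeasurable
  have : IsProbabilityMeasure (μ.map T) := Measure.isProbabilityMeasure_map hT.aemeasurable
  have : IsProbabilityMeasure (μ.map fun ω => (T ω, X ω)) :=
    Measure.isProbabilityMeasure_map (hT.prodMk hX).aemeasurable
  have h := klDiv_add_lintegral_neg_llr _ _ (map_prodMk_absolutelyContinuous hTX)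
  have hm : Measurable (llr (μ.map fun ω => (T ω, X ω)) ((μ.map T).prod (μ.map X))) :=
    measurable_llr _ _
  rw [lintegral_map (by fun_prop) (hT.prodMk hX), lintegral_map (by fun_prop) (hT.prodMk hX)] at h
  have hl := ae_llr_map_prodMk hTX hX hT
  have hp := ae_pointInfo_eq b hXT hX
  rw [mutualInfo]
  have e1 : ∫⁻ ω, ENNReal.ofReal (-pointInfo b μ T X ω) ∂μ
      = ENNReal.ofReal (Real.logb b (Real.exp 1)) * ∫⁻ ω, ENNReal.ofReal
        (-llr (μ.map fun ω => (T ω, X ω)) ((μ.map T).prod (μ.map X)) (T ω, X ω)) ∂μ := by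
    rw [← lintegral_const_mul' _ _ ENNReal.ofReal_ne_top]
    refine lintegral_congr_ae ((hl.and hp).mono fun ω hω => ?_)
    simp only [hω.1, hω.2, ← ENNReal.ofReal_mul hc, mul_neg]
  have e2 : ∫⁻ ω, ENNReal.ofReal (pointInfo b μ T X ω) ∂μ
      = ENNReal.ofReal (Real.logb b (Real.exp 1)) * ∫⁻ ω, ENNReal.ofReal
        (llr (μ.map fun ω => (T ω, X ω)) ((μ.map T).prod (μ.map X)) (T ω, X ω)) ∂μ := by
    rw [← lintegral_const_mul' _ _ ENNReal.ofReal_ne_top]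
    refine lintegral_congr_ae ((hl.and hp).mono fun ω hω => ?_)
    simp only [hω.1, hω.2, ← ENNReal.ofReal_mul hc]
  rw [e1, e2, ← mul_add, h]

/-- Mutual information is the mean specific information. -/
theorem mutualInfo_eq_lintegral_specificInfo (b : ℝ) (hb : 1 < b)
    (hXT : HasPDF (fun ω => (X ω, T ω)) μ volume) (hX : Measurable X) (hT : Measurable T) :
    mutualInfo b μ T X = ∫⁻ ω, specificInfo b μ X T (T ω) ∂μ := by
  have h := setLIntegral_specificInfo_add b hb hXT hX hT MeasurableSet.univ
  simp only [Set.preimage_univ, Measure.restrict_univ] at h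
  exact (ENNReal.add_left_inj (lintegral_neg_pointInfo_ne_top b hb hXT hX hT)).mp
    ((mutualInfo_add b hb hXT hX hT).trans h.symm)

end Information

/-! ### Unique information in closed form -/

section ClosedForms

variable {Ω : Type*} [MeasurableSpace Ω] {μ : Measure Ω} [IsProbabilityMeasure μ]
  {X Y T : Ω → ℝ}

/-- `I(T;X) - I_min(T;X,Y)` is the extended expectation, over the event that `X` is more specific
than `Y` about `T`, of the difference of the pointwise informations. -/
theorem uniqueMin_eq_expectation_pointInfo (b : ℝ) (hb : 1 < b)
    (hXT : HasPDF (fun ω => (X ω, T ω)) μ volume) (hYT : HasPDF (fun ω => (Y ω, T ω)) μ volume)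
    (hX : Measurable X) (hY : Measurable Y) (hT : Measurable T)
    (hdef : UniqueMinDefined b μ T X Y) :
    ExpectationExists μ ((eventA b μ T X Y).indicator fun ω =>
        pointInfo b μ T X ω - pointInfo b μ T Y ω) ∧
      uniqueMin b μ T X Y = expectation μ ((eventA b μ T X Y).indicator fun ω =>
        pointInfo b μ T X ω - pointInfo b μ T Y ω) := by
  have hsX := aemeasurable_specificInfo b hb (pdf_prod_swap hXT).1 hX
  have hsY := aemeasurable_specificInfo b hb (pdf_prod_swap hYT).1 hY
  -- a measurable version of the event, which depends on `T` only
  obtain ⟨S, hS, hSA⟩ : ∃ S : Set ℝ, MeasurableSet S ∧ eventA b μ T X Y =ᵐ[μ] T ⁻¹' S := by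
    refine ⟨{t | hsY.mk _ t ≤ hsX.mk _ t}, measurableSet_le hsY.measurable_mk hsX.measurable_mk, ?_⟩
    filter_upwards [ae_of_ae_map hT.aemeasurable hsX.ae_eq_mk,
      ae_of_ae_map hT.aemeasurable hsY.ae_eq_mk] with ω h1 h2
    change (specificInfo b μ X T (T ω) ≥ specificInfo b μ Y T (T ω))
      = (hsY.mk _ (T ω) ≤ hsX.mk _ (T ω))
    rw [h1, h2]
  have hTS : MeasurableSet (T ⁻¹' S) := hT hS
  have hA : ∀ᵐ ω ∂μ, ω ∈ T ⁻¹' S ↔ specificInfo b μ Y T (T ω) ≤ specificInfo b μ X T (T ω) :=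
    hSA.mono fun ω hω => (iff_of_eq hω).symm
  have hMI := mutualInfo_eq_lintegral_specificInfo b hb hXT hX hT
  -- both informations split over the event
  have hsplit : mutualInfo b μ T X = (∫⁻ ω in T ⁻¹' S, specificInfo b μ X T (T ω) ∂μ)
      + ∫⁻ ω in (T ⁻¹' S)ᶜ, specificInfo b μ X T (T ω) ∂μ := by
    rw [hMI, lintegral_add_compl _ hTS]
  have hred : redundancyMin b μ T X Y = (∫⁻ ω in T ⁻¹' S, specificInfo b μ Y T (T ω) ∂μ)
      + ∫⁻ ω in (T ⁻¹' S)ᶜ, specificInfo b μ X T (T ω) ∂μ := by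
    rw [redundancyMin, ← lintegral_add_compl _ hTS]
    congr 1
    · refine lintegral_congr_ae ((ae_restrict_iff' hTS).mpr (hA.mono fun ω h hω => ?_))
      exact min_eq_right (h.mp hω)
    · refine lintegral_congr_ae ((ae_restrict_iff' hTS.compl).mpr (hA.mono fun ω h hω => ?_))
      exact min_eq_left (le_of_not_ge fun h' => hω (h.mpr h'))
  have hle : redundancyMin b μ T X Y ≤ mutualInfo b μ T X := by
    rw [hMI]
    exact lintegral_mono fun ω => min_le_left _ _
  have hR : redundancyMin b μ T X Y ≠ ⊤ := fun h => hdef.1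
    ⟨by rw [top_le_iff.mp (h.symm.le.trans hle)]; rfl, by rw [h]; rfl⟩
  rw [hred, Ne, ENNReal.add_eq_top, not_or] at hR
  have iX := setLIntegral_specificInfo_add b hb hXT hX hT hS
  have iY := setLIntegral_specificInfo_add b hb hYT hY hT hS
  have nX : ∫⁻ ω in T ⁻¹' S, ENNReal.ofReal (-pointInfo b μ T X ω) ∂μ ≠ ⊤ :=
    ne_top_of_le_ne_top (lintegral_neg_pointInfo_ne_top b hb hXT hX hT)
      (setLIntegral_le_lintegral _ _)
  have nY : ∫⁻ ω in T ⁻¹' S, ENNReal.ofReal (-pointInfo b μ T Y ω) ∂μ ≠ ⊤ :=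
    ne_top_of_le_ne_top (lintegral_neg_pointInfo_ne_top b hb hYT hY hT)
      (setLIntegral_le_lintegral _ _)
  have mX := measurable_pointInfo (μ := μ) b hX hT
  have mY := measurable_pointInfo (μ := μ) b hY hT
  have hind : (eventA b μ T X Y).indicator (fun ω => pointInfo b μ T X ω - pointInfo b μ T Y ω)
      =ᵐ[μ] (T ⁻¹' S).indicator fun ω => pointInfo b μ T X ω - pointInfo b μ T Y ω :=
    indicator_ae_eq_of_ae_eq_set hSA
  have key := expectation_of_parts (μ := μ)
    (f := (T ⁻¹' S).indicator fun ω => pointInfo b μ T X ω - pointInfo b μ T Y ω)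
    (P := (T ⁻¹' S).indicator fun ω =>
      ENNReal.ofReal (pointInfo b μ T X ω) + ENNReal.ofReal (-pointInfo b μ T Y ω))
    (N := (T ⁻¹' S).indicator fun ω =>
      ENNReal.ofReal (-pointInfo b μ T X ω) + ENNReal.ofReal (pointInfo b μ T Y ω))
    ((mX.sub mY).indicator hTS).aemeasurable
    ((mX.ennreal_ofReal.add mY.neg.ennreal_ofReal).indicator hTS).aemeasurable
    ((mX.neg.ennreal_ofReal.add mY.ennreal_ofReal).indicator hTS).aemeasurable
    (ae_of_all _ fun ω => by
      by_cases hω : ω ∈ T ⁻¹' S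
      · simp only [Set.indicator_of_mem hω]
        exact ofReal_sub_add_eq _ _
      · simp [Set.indicator_of_notMem hω])
  rw [lintegral_indicator hTS, lintegral_indicator hTS,
    lintegral_add_left mX.ennreal_ofReal,
    lintegral_add_left (f := fun ω => ENNReal.ofReal (-pointInfo b μ T X ω)) mX.neg.ennreal_ofReal,
    ← iX, ← iY] at key
  -- of the four integrals left, only that of the specific information of `X` may be infinite
  obtain ⟨hex, hval⟩ := key (Or.inr (by simp [nX, nY, hR.1]))
  refine ⟨hex.congr hind.symm, ?_⟩
  rw [expectation_congr hind, hval, uniqueMin, hsplit, hred]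
  revert hR nX nY
  generalize (∫⁻ ω in T ⁻¹' S, ENNReal.ofReal (-pointInfo b μ T X ω) ∂μ) = p
  generalize (∫⁻ ω in T ⁻¹' S, ENNReal.ofReal (-pointInfo b μ T Y ω) ∂μ) = q
  generalize (∫⁻ ω in T ⁻¹' S, specificInfo b μ X T (T ω) ∂μ) = i
  generalize (∫⁻ ω in T ⁻¹' S, specificInfo b μ Y T (T ω) ∂μ) = j
  generalize (∫⁻ ω in (T ⁻¹' S)ᶜ, specificInfo b μ X T (T ω) ∂μ) = k
  intro hR nX nY
  have h1 : (i : EReal) - j = ((i + k : ℝ≥0∞) : EReal) - ((j + k : ℝ≥0∞) : EReal) :=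
    ereal_sub_eq_of_add_eq_add (by ring) le_self_add le_self_add (Or.inr (by simp [hR]))
  have h2 : (i : EReal) - j = ((i + p + q : ℝ≥0∞) : EReal) - ((p + (j + q) : ℝ≥0∞) : EReal) :=
    ereal_sub_eq_of_add_eq_add (by ring) (by rw [add_assoc]; exact le_self_add)
      (by rw [← add_assoc, add_comm p, add_assoc]; exact le_self_add)
      (Or.inr (by simp [hR, nX, nY]))
  exact h1.symm.trans h2

/-- Subtracting a pointwise minimum leaves the difference on the event where it is attained by the
second function. -/
theorem sub_min_eq_indicator {Ω : Type*} (f h : Ω → ℝ) (ω : Ω) :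
    f ω - min (f ω) (h ω) = {ω | h ω ≤ f ω}.indicator (fun ω => f ω - h ω) ω := by
  by_cases hω : h ω ≤ f ω
  · simp [hω]
  · simp [hω, le_of_not_ge hω]

theorem uniquePMPlus_eq (b : ℝ) (hb : 1 < b) (hX : HasPDF X μ volume) (hY : HasPDF Y μ volume)
    (hdef : UniquePMPlusDefined b μ X Y) :
    ExpectationExists μ ((eventB μ X Y).indicator (logDensRatio b μ X Y)) ∧
      uniquePMPlus b μ X Y = expectation μ ((eventB μ X Y).indicator (logDensRatio b μ X Y)) := by
  obtain ⟨h1, h2, h3⟩ := hdef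
  have hae : (fun ω => pointSpec b μ X ω - pointSpecRed b μ X Y ω)
      =ᵐ[μ] (eventB μ X Y).indicator (logDensRatio b μ X Y) := by
    filter_upwards [dens_pos (μ := μ) X, dens_pos (μ := μ) Y] with ω hx hy
    rw [pointSpecRed, sub_min_eq_indicator]
    have hiff : pointSpec b μ Y ω ≤ pointSpec b μ X ω ↔ ω ∈ eventB μ X Y := by
      rw [pointSpec, pointSpec, Real.logb_le_logb hb (by positivity) (by positivity),
        one_div_le_one_div hy hx]
      rfl
    by_cases h : ω ∈ eventB μ X Y
    · rw [Set.indicator_of_mem h, Set.indicator_of_mem (by exact hiff.mpr h), logDensRatio,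
        pointSpec, pointSpec, ← Real.logb_div (by positivity) (by positivity)]
      congr 1
      field_simp
    · rw [Set.indicator_of_notMem h, Set.indicator_of_notMem (by exact fun h' => h (hiff.mp h'))]
  obtain ⟨hex, hval⟩ := expectation_sub h1 h2 h3
  exact ⟨hex.congr hae, by rw [uniquePMPlus, ← hval, expectation_congr hae]⟩

theorem uniquePMMinus_eq {g : ℝ × ℝ → ℝ} (b : ℝ) (hb : 1 < b) (hI : IsNFBI μ X Y T g)
    (hW : IsWellBehaved μ X Y g) (hdef : UniquePMMinusDefined b μ T X Y) :
    ExpectationExists μ ((eventC X Y g).indicator (logDerivRatio b X Y g)) ∧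
      uniquePMMinus b μ T X Y
        = expectation μ ((eventC X Y g).indicator (logDerivRatio b X Y g)) := by
  obtain ⟨h1, h2, h3⟩ := hdef
  have hae : (fun ω => pointAmb b μ T X ω - pointAmbRed b μ T X Y ω)
      =ᵐ[μ] (eventC X Y g).indicator (logDerivRatio b X Y g) := by
    filter_upwards [ae_abs_dY_mul_condDens_eq hI hW]
      with ω ⟨⟨hdx, hdy⟩, ⟨hcx, hcy⟩, he⟩
    rw [pointAmbRed, sub_min_eq_indicator]
    have hiff : pointAmb b μ T Y ω ≤ pointAmb b μ T X ω ↔ ω ∈ eventC X Y g := by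
      rw [pointAmb, pointAmb, Real.logb_le_logb hb (by positivity) (by positivity),
        one_div_le_one_div hcy hcx]
      change _ ↔ |dX g (X ω, Y ω)| ≤ |dY g (X ω, Y ω)|
      constructor <;> intro h <;> by_contra! h' <;> nlinarith
    by_cases h : ω ∈ eventC X Y g
    · rw [Set.indicator_of_mem h, Set.indicator_of_mem (by exact hiff.mpr h), logDerivRatio,
        pointAmb, pointAmb, ← Real.logb_div (by positivity) (by positivity)]
      congr 1
      field_simp
      linarith
    · rw [Set.indicator_of_notMem h, Set.indicator_of_notMem (by exact fun h' => h (hiff.mp h'))]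
  obtain ⟨hex, hval⟩ := expectation_sub h1 h2 h3
  exact ⟨hex.congr hae, by rw [uniquePMMinus, ← hval, expectation_congr hae]⟩

theorem uniqueMin_eq {g : ℝ × ℝ → ℝ} (b : ℝ) (hI : IsNFBI μ X Y T g) (hb : 1 < b)
    (hW : IsWellBehaved μ X Y g) (hdef : UniqueMinDefined b μ T X Y) :
    ExpectationExists μ ((eventA b μ T X Y).indicator fun ω =>
        logDensRatio b μ X Y ω - logDerivRatio b X Y g ω) ∧
      uniqueMin b μ T X Y = expectation μ ((eventA b μ T X Y).indicator fun ω =>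
        logDensRatio b μ X Y ω - logDerivRatio b X Y g ω) := by
  have hXT := (hasPDF_fst_target hI hW).1
  have hYT := (hasPDF_snd_target hI hW).1
  obtain ⟨hX, -⟩ := hasPDF_marginals hXT
  obtain ⟨hY, -⟩ := hasPDF_marginals hYT
  obtain ⟨hex, hval⟩ := uniqueMin_eq_expectation_pointInfo b hb hXT hYT hI.measurable_X
    hI.measurable_Y hI.measurable_T hdef
  have hae : (eventA b μ T X Y).indicator (fun ω => pointInfo b μ T X ω - pointInfo b μ T Y ω)
      =ᵐ[μ] (eventA b μ T X Y).indicator fun ω =>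
        logDensRatio b μ X Y ω - logDerivRatio b X Y g ω := by
    filter_upwards [dens_pos (μ := μ) X, dens_pos (μ := μ) Y,
      ae_abs_dY_mul_condDens_eq hI hW] with ω hx hy ⟨⟨hdx, hdy⟩, ⟨hcx, hcy⟩, he⟩
    by_cases h : ω ∈ eventA b μ T X Y
    · rw [Set.indicator_of_mem h, Set.indicator_of_mem h, pointInfo, pointInfo, logDensRatio,
        logDerivRatio, ← Real.logb_div (by positivity) (by positivity),
        ← Real.logb_div (by positivity) (by positivity)]
      congr 1
      field_simp
      linarith
    · rw [Set.indicator_of_notMem h, Set.indicator_of_notMem h]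
  exact ⟨hex.congr hae, hval.trans (expectation_congr hae)⟩

end ClosedForms

/-! ### Gaussian predictors -/

section Gaussian

theorem integral_abs_gaussianReal_zero (v : NNReal) :
    ∫ x, |x| ∂(gaussianReal 0 v) = Real.sqrt (2 * v / Real.pi) := by
  rcases eq_or_ne v 0 with rfl | hv
  · simp
  have hv' : (0 : ℝ) < v := by positivity
  have h1 : ∫ x : ℝ in Set.Ioi 0, x ^ (1 : ℝ) * Real.exp (-(1 / (2 * (v : ℝ))) * x ^ (2 : ℝ))
      = v := by
    rw [integral_rpow_mul_exp_neg_mul_rpow two_pos (by norm_num) (by positivity)]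
    norm_num
    rw [Real.rpow_neg_one]
    field_simp
  have h2 : ∀ x : ℝ, gaussianPDFReal 0 v x • |x|
      = (fun y : ℝ => (Real.sqrt (2 * Real.pi * v))⁻¹
        * (y ^ (1 : ℝ) * Real.exp (-(1 / (2 * (v : ℝ))) * y ^ (2 : ℝ)))) |x| := by
    intro x
    simp only [gaussianPDFReal, smul_eq_mul, sub_zero, Real.rpow_one, Real.rpow_two, sq_abs]
    rw [show -x ^ 2 / (2 * (v : ℝ)) = -(1 / (2 * (v : ℝ))) * x ^ 2 by ring]
    ring
  rw [integral_gaussianReal_eq_integral_smul hv]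
  rw [integral_congr_ae (ae_of_all _ h2), integral_comp_abs (f := fun y : ℝ =>
    (Real.sqrt (2 * Real.pi * v))⁻¹ * (y ^ (1 : ℝ) * Real.exp (-(1 / (2 * (v : ℝ))) * y ^ (2 : ℝ)))),
    integral_const_mul, h1, eq_comm, Real.sqrt_eq_iff_mul_self_eq_of_pos (by positivity)]
  have h3 : Real.sqrt (2 * Real.pi * v) ^ 2 = 2 * Real.pi * v := Real.sq_sqrt (by positivity)
  field_simp
  rw [h3]

variable {Ω : Type*} [MeasurableSpace Ω] {μ : Measure Ω} {X Y : Ω → ℝ}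

theorem expectation_eq_integral {f : Ω → ℝ} (hf : Integrable f μ) :
    ExpectationExists μ f ∧ expectation μ f = ((∫ ω, f ω ∂μ : ℝ) : EReal) := by
  have h1 : ∫⁻ ω, ENNReal.ofReal (f ω) ∂μ ≠ ⊤ := hf.lintegral_lt_top.ne
  have h2 : ∫⁻ ω, ENNReal.ofReal (-f ω) ∂μ ≠ ⊤ := hf.neg.lintegral_lt_top.ne
  refine ⟨⟨hf.aemeasurable, Or.inl h1⟩, ?_⟩
  rw [integral_eq_lintegral_pos_part_sub_lintegral_neg_part hf, EReal.coe_sub,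
    EReal.coe_ennreal_toReal h1, EReal.coe_ennreal_toReal h2]
  rfl

theorem integral_abs_of_hasGaussianLaw {Z : Ω → ℝ} (hZ : HasGaussianLaw Z μ)
    (h0 : ∫ ω, Z ω ∂μ = 0) :
    ∫ ω, |Z ω| ∂μ = Real.sqrt (2 * variance Z μ / Real.pi) := by
  have h := hZ.map_eq_gaussianReal
  rw [h0] at h
  rw [← integral_map (f := fun x => |x|) hZ.aemeasurable (by fun_prop), h,
    integral_abs_gaussianReal_zero, Real.coe_toNNReal _ (variance_nonneg _ _)]

theorem ae_dens_eq_gaussianPDFReal [IsProbabilityMeasure μ] (hpdf : HasPDF X μ volume)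
    (hX : HasGaussianLaw X μ) (h0 : ∫ ω, X ω ∂μ = 0) (h1 : variance X μ = 1) :
    ∀ᵐ ω ∂μ, dens μ X (X ω) = gaussianPDFReal 0 1 (X ω) := by
  have h := hX.map_eq_gaussianReal
  rw [h0, h1, Real.toNNReal_one, gaussianReal_of_var_ne_zero 0 one_ne_zero] at h
  have h' := (pdf.eq_of_map_eq_withDensity _ (measurable_gaussianPDF 0 1).aemeasurable).mp h
  have hac : μ.map X ≪ volume := HasPDF.absolutelyContinuous
  filter_upwards [ae_of_ae_map hX.aemeasurable (hac.ae_le h')] with ω hω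
  rw [dens, hω, toReal_gaussianPDF]

/-- `X² - Y² = (X - Y)(X + Y)` is a product of independent centred Gaussian variables of variances
`2 (1 - ρ)` and `2 (1 + ρ)`. -/
theorem integral_abs_sq_sub_sq [IsProbabilityMeasure μ] {ρ : ℝ}
    (h : IsNormalizedGaussian μ X Y ρ) :
    ∫ ω, |X ω ^ 2 - Y ω ^ 2| ∂μ = 4 / Real.pi * Real.sqrt (1 - ρ ^ 2) := by
  have hX := h.gaussian.fst
  have hY := h.gaussian.snd
  have hX2 := hX.memLp_two
  have hY2 := hY.memLp_two
  have hjoint : HasGaussianLaw (fun ω => ((X - Y) ω, (X + Y) ω)) μ :=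
    h.gaussian.map_fun (((ContinuousLinearMap.fst ℝ ℝ ℝ) - (ContinuousLinearMap.snd ℝ ℝ ℝ)).prod
      ((ContinuousLinearMap.fst ℝ ℝ ℝ) + (ContinuousLinearMap.snd ℝ ℝ ℝ)))
  have hcov : covariance (X - Y) (X + Y) μ = 0 := by
    rw [covariance_sub_left hX2 hY2 (hX2.add hY2), covariance_add_right hX2 hX2 hY2,
      covariance_add_right hY2 hX2 hY2, covariance_self hX2.aemeasurable,
      covariance_self hY2.aemeasurable, h.var_X, h.var_Y, covariance_comm Y X]
    ring
  have hind := (hjoint.indepFun_of_covariance_eq_zero hcov).comp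
    (φ := fun x : ℝ => |x|) (ψ := fun x : ℝ => |x|) (by fun_prop) (by fun_prop)
  have hm1 : ∫ ω, (X - Y) ω ∂μ = 0 := by
    simp only [Pi.sub_apply]
    rw [integral_sub hX.integrable hY.integrable, h.mean_X, h.mean_Y, sub_zero]
  have hm2 : ∫ ω, (X + Y) ω ∂μ = 0 := by
    simp only [Pi.add_apply]
    rw [integral_add hX.integrable hY.integrable, h.mean_X, h.mean_Y, add_zero]
  have hv1 : variance (X - Y) μ = 2 - 2 * ρ := by
    rw [variance_sub hX2 hY2, h.var_X, h.var_Y, h.cov_XY]; ring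
  have hv2 : variance (X + Y) μ = 2 + 2 * ρ := by
    rw [variance_add hX2 hY2, h.var_X, h.var_Y, h.cov_XY]; ring
  have hn1 : 0 ≤ 2 - 2 * ρ := hv1 ▸ variance_nonneg _ _
  have hn2 : 0 ≤ 2 + 2 * ρ := hv2 ▸ variance_nonneg _ _
  have hprod := hind.integral_fun_mul_eq_mul_integral
    hjoint.fst.aemeasurable.norm.aestronglyMeasurable
    hjoint.snd.aemeasurable.norm.aestronglyMeasurable
  simp only [Function.comp_apply] at hprod
  rw [integral_abs_of_hasGaussianLaw hjoint.fst hm1, integral_abs_of_hasGaussianLaw hjoint.snd hm2,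
    hv1, hv2, ← Real.sqrt_mul (by positivity)] at hprod
  have e : ∀ ω, |X ω ^ 2 - Y ω ^ 2| = |(X - Y) ω| * |(X + Y) ω| := fun ω => by
    rw [← abs_mul]; congr 1; simp only [Pi.sub_apply, Pi.add_apply]; ring
  simp_rw [e]
  rw [hprod, show 2 * (2 - 2 * ρ) / Real.pi * (2 * (2 + 2 * ρ) / Real.pi)
    = (4 / Real.pi) ^ 2 * (1 - ρ ^ 2) by field_simp; ring, Real.sqrt_mul (by positivity),
    Real.sqrt_sq (by positivity)]

theorem logb_one_div_gaussianPDFReal (b x : ℝ) :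
    Real.logb b (1 / gaussianPDFReal 0 1 x)
      = Real.logb b (Real.exp 1) / 2 * x ^ 2 + Real.logb b (Real.sqrt (2 * Real.pi)) := by
  have h : 1 / gaussianPDFReal 0 1 x = Real.sqrt (2 * Real.pi) * Real.exp (x ^ 2 / 2) := by
    simp only [gaussianPDFReal, NNReal.coe_one, mul_one, sub_zero]
    rw [neg_div, Real.exp_neg]
    simp [mul_comm]
  rw [h, Real.logb_mul (by positivity) (by positivity)]
  simp only [Real.logb, Real.log_exp]
  ring

theorem ae_logDensRatio_gaussian [IsProbabilityMeasure μ] (b : ℝ) {ρ : ℝ}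
    (hX : HasPDF X μ volume) (hY : HasPDF Y μ volume) (h : IsNormalizedGaussian μ X Y ρ) :
    ∀ᵐ ω ∂μ, logDensRatio b μ X Y ω
      = Real.logb b (Real.exp 1) / 2 * (X ω ^ 2 - Y ω ^ 2) := by
  filter_upwards [dens_pos (μ := μ) X, dens_pos (μ := μ) Y,
    ae_dens_eq_gaussianPDFReal hX h.gaussian.fst h.mean_X h.var_X,
    ae_dens_eq_gaussianPDFReal hY h.gaussian.snd h.mean_Y h.var_Y] with ω hx hy h1 h2
  have e1 := logb_one_div_gaussianPDFReal b (X ω)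
  have e2 := logb_one_div_gaussianPDFReal b (Y ω)
  rw [← h1, one_div, Real.logb_inv] at e1
  rw [← h2, one_div, Real.logb_inv] at e2
  rw [logDensRatio, Real.logb_div hy.ne' hx.ne']
  linarith

theorem integrable_pointSpec_gaussian [IsProbabilityMeasure μ] (b : ℝ)
    (hpdf : HasPDF X μ volume) (hX : HasGaussianLaw X μ) (h0 : ∫ ω, X ω ∂μ = 0)
    (h1 : variance X μ = 1) : Integrable (pointSpec b μ X) μ := by
  refine ((hX.memLp_two.integrable_sq.const_mul (Real.logb b (Real.exp 1) / 2)).add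
    (integrable_const (Real.logb b (Real.sqrt (2 * Real.pi))))).congr ?_
  filter_upwards [ae_dens_eq_gaussianPDFReal hpdf hX h0 h1] with ω hω
  rw [pointSpec, hω, logb_one_div_gaussianPDFReal]
  rfl

theorem diffDefined_coe (x y : ℝ) : DiffDefined (x : EReal) (y : EReal) := by
  simp [DiffDefined]

theorem uniquePMPlus_gaussian [IsProbabilityMeasure μ] (b : ℝ) (hb : 1 < b) {ρ : ℝ}
    (hX : HasPDF X μ volume) (hY : HasPDF Y μ volume) (h : IsNormalizedGaussian μ X Y ρ) :
    UniquePMPlusDefined b μ X Y ∧ uniquePMPlus b μ X Y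
      = ((Real.logb b (Real.exp 1) / Real.pi * Real.sqrt (1 - ρ ^ 2) : ℝ) : EReal) := by
  have iX := integrable_pointSpec_gaussian b hX h.gaussian.fst h.mean_X h.var_X
  have iY := integrable_pointSpec_gaussian b hY h.gaussian.snd h.mean_Y h.var_Y
  have iM : Integrable (pointSpecRed b μ X Y) μ := iX.inf iY
  obtain ⟨e1, v1⟩ := expectation_eq_integral iX
  obtain ⟨e2, v2⟩ := expectation_eq_integral iM
  have hdef : UniquePMPlusDefined b μ X Y := ⟨e1, e2, by rw [v1, v2]; exact diffDefined_coe _ _⟩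
  refine ⟨hdef, ?_⟩
  have hc : 0 < Real.logb b (Real.exp 1) :=
    Real.logb_pos hb (Real.one_lt_exp_iff.mpr zero_lt_one)
  have hX2 := h.gaussian.fst.memLp_two
  have hY2 := h.gaussian.snd.memLp_two
  have hsq : Integrable (fun ω => X ω ^ 2 - Y ω ^ 2) μ := hX2.integrable_sq.sub hY2.integrable_sq
  have hsq0 : ∫ ω, (X ω ^ 2 - Y ω ^ 2) ∂μ = 0 := by
    have h1 := h.var_X
    have h2 := h.var_Y
    rw [variance_of_integral_eq_zero hX2.aemeasurable h.mean_X] at h1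
    rw [variance_of_integral_eq_zero hY2.aemeasurable h.mean_Y] at h2
    rw [integral_sub hX2.integrable_sq hY2.integrable_sq, h1, h2, sub_self]
  -- `B` is the event that the log-ratio is nonnegative, so the indicator gives its positive part
  have hae : (eventB μ X Y).indicator (logDensRatio b μ X Y) =ᵐ[μ]
      fun ω => Real.logb b (Real.exp 1) / 4 * ((X ω ^ 2 - Y ω ^ 2) + |X ω ^ 2 - Y ω ^ 2|) := by
    filter_upwards [ae_logDensRatio_gaussian b hX hY h, dens_pos (μ := μ) X,
      dens_pos (μ := μ) Y] with ω hω hx hy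
    have hiff : ω ∈ eventB μ X Y ↔ 0 ≤ X ω ^ 2 - Y ω ^ 2 := by
      rw [← mul_nonneg_iff_of_pos_left (half_pos hc), ← hω, logDensRatio,
        Real.logb_nonneg_iff hb (div_pos hy hx), one_le_div hx]
      rfl
    by_cases hB : ω ∈ eventB μ X Y
    · rw [Set.indicator_of_mem hB, hω, abs_of_nonneg (hiff.mp hB)]
      ring
    · rw [Set.indicator_of_notMem hB, abs_of_neg (not_le.mp (hiff.not.mp hB))]
      ring
  rw [(uniquePMPlus_eq b hb hX hY hdef).2, expectation_congr hae,
    (expectation_eq_integral (by exact (hsq.add hsq.abs).const_mul _)).2,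
    integral_const_mul, integral_add hsq hsq.abs, hsq0, integral_abs_sq_sub_sq h]
  congr 1
  ring

end Gaussian

end PIDCont

/-! ### Unique information of well-behaved interactions -/

theorem mainTheorem1 {Ω : Type*} [MeasurableSpace Ω] (μ : Measure Ω) [IsProbabilityMeasure μ]
    (b : ℝ) (hb : 1 < b) (X Y T : Ω → ℝ) (g : ℝ × ℝ → ℝ)
    (hI : PIDCont.IsNFBI μ X Y T g) (hW : PIDCont.IsWellBehaved μ X Y g) :
    -- the densities `p_T`, `p_{X,T}`, `p_{Y,T}` exist
    (HasPDF T μ volume ∧ HasPDF (fun ω => (X ω, T ω)) μ volume ∧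
      HasPDF (fun ω => (Y ω, T ω)) μ volume) ∧
    -- unique information for `I_min`
    (PIDCont.UniqueMinDefined b μ T X Y →
      PIDCont.ExpectationExists μ ((PIDCont.eventA b μ T X Y).indicator fun ω =>
        PIDCont.logDensRatio b μ X Y ω - PIDCont.logDerivRatio b X Y g ω) ∧
      PIDCont.uniqueMin b μ T X Y =
        PIDCont.expectation μ ((PIDCont.eventA b μ T X Y).indicator fun ω =>
          PIDCont.logDensRatio b μ X Y ω - PIDCont.logDerivRatio b X Y g ω)) ∧
    -- unique specificity for `I_PM`
    (PIDCont.UniquePMPlusDefined b μ X Y →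
      PIDCont.ExpectationExists μ
        ((PIDCont.eventB μ X Y).indicator (PIDCont.logDensRatio b μ X Y)) ∧
      PIDCont.uniquePMPlus b μ X Y =
        PIDCont.expectation μ
          ((PIDCont.eventB μ X Y).indicator (PIDCont.logDensRatio b μ X Y))) ∧
    -- unique ambiguity for `I_PM`
    (PIDCont.UniquePMMinusDefined b μ T X Y →
      PIDCont.ExpectationExists μ
        ((PIDCont.eventC X Y g).indicator (PIDCont.logDerivRatio b X Y g)) ∧
      PIDCont.uniquePMMinus b μ T X Y =
        PIDCont.expectation μ
          ((PIDCont.eventC X Y g).indicator (PIDCont.logDerivRatio b X Y g))) ∧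
    -- unique information for `I_PM`
    (PIDCont.UniquePMDefined b μ T X Y →
      PIDCont.uniquePM b μ T X Y =
        PIDCont.expectation μ
            ((PIDCont.eventB μ X Y).indicator (PIDCont.logDensRatio b μ X Y))
          - PIDCont.expectation μ
            ((PIDCont.eventC X Y g).indicator (PIDCont.logDerivRatio b X Y g))) ∧
    -- normalized Gaussian predictors
    (∀ ρ : ℝ, PIDCont.IsNormalizedGaussian μ X Y ρ →
      (∀ᵐ ω ∂μ, PIDCont.logDensRatio b μ X Y ω =
        Real.logb b (Real.exp 1) / 2 * (X ω ^ 2 - Y ω ^ 2)) ∧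
      (PIDCont.UniqueMinDefined b μ T X Y →
        PIDCont.ExpectationExists μ ((PIDCont.eventA b μ T X Y).indicator fun ω =>
          Real.logb b (Real.exp 1) / 2 * (X ω ^ 2 - Y ω ^ 2)
            - PIDCont.logDerivRatio b X Y g ω) ∧
        PIDCont.uniqueMin b μ T X Y =
          PIDCont.expectation μ ((PIDCont.eventA b μ T X Y).indicator fun ω =>
            Real.logb b (Real.exp 1) / 2 * (X ω ^ 2 - Y ω ^ 2)
              - PIDCont.logDerivRatio b X Y g ω)) ∧
      PIDCont.UniquePMPlusDefined b μ X Y ∧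
      PIDCont.uniquePMPlus b μ X Y =
        ((Real.logb b (Real.exp 1) / Real.pi * Real.sqrt (1 - ρ ^ 2) : ℝ) : EReal) ∧
      (PIDCont.UniquePMMinusDefined b μ T X Y →
        PIDCont.uniquePM b μ T X Y =
          ((Real.logb b (Real.exp 1) / Real.pi * Real.sqrt (1 - ρ ^ 2) : ℝ) : EReal)
            - PIDCont.expectation μ
              ((PIDCont.eventC X Y g).indicator (PIDCont.logDerivRatio b X Y g)))) := by
  obtain ⟨hXT, -⟩ := PIDCont.hasPDF_fst_target hI hW
  obtain ⟨hYT, -⟩ := PIDCont.hasPDF_snd_target hI hW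
  obtain ⟨hX, hT⟩ := PIDCont.hasPDF_marginals hXT
  obtain ⟨hY, -⟩ := PIDCont.hasPDF_marginals hYT
  refine ⟨⟨hT, hXT, hYT⟩, PIDCont.uniqueMin_eq b hI hb hW, PIDCont.uniquePMPlus_eq b hb hX hY,
    PIDCont.uniquePMMinus_eq b hb hI hW, ?_, fun ρ hρ => ?_⟩
  · rintro ⟨hplus, hminus, -⟩
    rw [PIDCont.uniquePM, (PIDCont.uniquePMPlus_eq b hb hX hY hplus).2,
      (PIDCont.uniquePMMinus_eq b hb hI hW hminus).2]
  · have hratio := PIDCont.ae_logDensRatio_gaussian b hX hY hρ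
    obtain ⟨hplus, hval⟩ := PIDCont.uniquePMPlus_gaussian b hb hX hY hρ
    refine ⟨hratio, fun hmin => ?_, hplus, hval, fun hminus => ?_⟩
    · obtain ⟨hex, heq⟩ := PIDCont.uniqueMin_eq b hI hb hW hmin
      have hae : (PIDCont.eventA b μ T X Y).indicator (fun ω =>
            PIDCont.logDensRatio b μ X Y ω - PIDCont.logDerivRatio b X Y g ω)
          =ᵐ[μ] (PIDCont.eventA b μ T X Y).indicator fun ω =>
            Real.logb b (Real.exp 1) / 2 * (X ω ^ 2 - Y ω ^ 2)
              - PIDCont.logDerivRatio b X Y g ω := by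
        filter_upwards [hratio] with ω hω
        simp only [Set.indicator, hω]
      exact ⟨hex.congr hae, heq.trans (PIDCont.expectation_congr hae)⟩
    · rw [PIDCont.uniquePM, hval, (PIDCont.uniquePMMinus_eq b hb hI hW hminus).2]
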